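/- **Circular systems.** Let $\langle k_n,l_n\rangle_{n\in\mathbb N}$ be positive integers with $k_n\ge 2$ and $\sum_n 1/l_n<\infty$. Put $p_0=0$, $q_0=1$, $p_{n+1}=p_nq_nk_nl_n+1$, $q_{n+1}=k_nl_nq_n^2$, and let $\alpha=\lim p_n/q_n$. Let $\Sigma$ be a non-empty countable alphabet and $b,e\notin\Sigma$. For words $w_0,\dots,w_{k_n-1}$ in $\Sigma\cup\{b,e\}$ of length $q_n$ put $$\mathcal C_n(w_0,\dots,w_{k_n-1})=\prod_{i=0}^{q_n-1}\prod_{j=0}^{k_n-1} b^{q_n-j_i}\,w_j^{\,l_n-1}\,e^{j_i},\qquad 0\le j_i<q_n,\quad j_i\equiv p_n^{-1}i \pmod{q_n}.$$ The part of this word in the powers $w_j^{l_n-1}$ is its interior, the rest its boundary; the factors $b^{q_n-j_i}w_j^{l_n-1}e^{j_i}$ are its 1-subsections and the factors $\prod_{j}b^{q_n-j_i}w_j^{l_n-1}e^{j_i}$ its 2-subsections. A circular construction sequence is given by $\mathcal W_0=\Sigma$ and $\mathcal W_{n+1}=\{\mathcal C_n(v):v\in P_{n+1}\}$ with $P_{n+1}\subseteq\mathcal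 W_n^{k_n}$, where every $w\in\mathcal W_n$ occurs in every $w'\in\mathcal W_{n+1}$, and where $P_{n+1}$, as a set of words in the alphabet $\mathcal W_n$, is uniquely readable ($uv=pws$ with $u,v,w\in P_{n+1}$ implies that $p$ or $s$ is empty). $\mathbb K^c$ is the set of $x\in(\Sigma\cup\{b,e\})^{\mathbb Z}$ all of whose finite subwords occur in words of $\bigcup_n\mathcal W_n$, and $S\subseteq\mathbb K^c$ is the set of $x$ for which there are $a_m,b_m\to\infty$ with every $x\restriction[-a_m,b_m)$ in $\bigcup_n\mathcal W_n$. The sequence is uniform if there are a summable sequence of positive numbers $\delta_n$ and $d_n:\mathcal W_n\to(0,1)$ such that $|f(w,w')/(q_{n+1}/q_n)-d_n(w)|<\delta_{n+1}/q_n$ for all $w\in\mathcal W_n$, $w'=\mathcal C_n(v)\in\mathcal W_{n+1}$, where $f(w,w')$ is the number of displayed $n$-subwords of $\mathcal C_n(v)$ equal to $w$. Let $T$ be the shift, $(Tx)(i)=x(i+1)$, and let $\nu$ be a shift-invariant Borel probability measure with $\nu(S)=1$ (for a uniform system there is exactly one). **The circle factor.** Let $w^\alpha_0=*$, $w^\alpha_{n+1}=\mathcal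 C_n(w^\alpha_n,\dots,w^\alpha_n)$, let $\mathcal K$ be the symbolic shift of the sequence $\langle\{w_n^\alpha\}\rangle_n$, and let $\pi:\mathbb K^c\to\mathcal K$ replace all letters of $\Sigma$ by $*$. If $s\restriction[-r,q_n-r)=w_n^\alpha$ with $0\le r<q_n$, then $[-r,q_n-r)$ is the principal $n$-block of $s$ and $r_n(s)=r$. Let $\phi_0(s)=\lim_n p_nr_n(s)/q_n\in\mathbb R/\mathbb Z$; this is an isomorphism of $\mathcal K$ with the rotation by $\alpha$. For $\beta\in\mathbb R/\mathbb Z=[0,1)$, $\mathcal S_\beta=\phi_0^{-1}\circ(x\mapsto x+\beta)\circ\phi_0$. An invertible measure preserving $\phi$ of $(\mathbb K^c,\nu)$ has rotation factor $\phi^\pi=\mathcal S_\beta$ if $\pi\circ\phi=\mathcal S_\beta\circ\pi$ a.e. **Central values.** Fix a decreasing summable sequence $\varepsilon_n\in[0,1)$ with $\varepsilon_N>\sum_{n>N}\varepsilon_n$. Call $n$ mature for $s\in\mathcal K$ if for all $m\ge n$: $s$ has a principal $m$-block and $0$ is not in its boundary; and, in its principal $(m+1)$-block, $0$ is not in one of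 the first or last $\varepsilon_ml_m$ copies of $w^\alpha_m$ in a power $(w_m^\alpha)^{l_m-1}$, nor in one of the first or last $\varepsilon_mk_m$ 1-subsections of a 2-subsection, nor in one of the first or last $\varepsilon_mq_m$ 2-subsections. For $t=\mathcal S_\beta(s)$ let $d^n(s)\in\{0,\dots,q_n-1\}$, $d^n(s)\equiv r_n(t)-r_n(s)\pmod{q_n}$. The point $s$ is ill-$\beta$-matched at stage $n$ if $n$ is mature for $s$ and the principal $n$-blocks of $T^{d^{n+1}(s)-d^n(s)}s$ and of $s$ come from the $j_0$-th and the $j_1$-st argument of $\mathcal C_n(w_n^\alpha,\dots,w_n^\alpha)$ with $j_0\ne j_1$. Let $\Delta(\beta)=\sum_n\nu\{s:\pi(s)\text{ is ill-}\beta\text{-matched at stage }n\}$; $\beta$ is central if $\Delta(\beta)<\infty$. **Theorem.** Suppose that the circular construction sequence is uniform and that $\beta$ is central. Then there are integers $A_n$ and an invertible $\nu$-preserving transformation $T^*$ (invertible up to null sets) commuting a.e. with $T$ such that $T^{A_n}s\to T^*s$ (in the product topology) for $\nu$-almost every $s$, $T^{A_n}\to T^*$ in the weak topology (the weak operator topology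 on the Koopman operators on $L^2(\nu)$), and $(T^*)^\pi=\mathcal S_\beta$. In particular $T^*\in\overline{\{T^n:n\in\mathbb Z\}}$ (weak closure), so every central value is the rotation factor of an element of the weak closure of the powers of $T$. -/

import Mathlib

open MeasureTheory Filter Topology

namespace Circular

/-! ### Symbolic shifts -/

section Symbolic

variable {Γ : Type*}

/-- The `a`-th power of the shift map on bi-infinite sequences, `(sh^a x)(i) = x(i + a)`. -/
def shiftZ (a : ℤ) (x : ℤ → Γ) : ℤ → Γ := fun i => x (i + a)

/-- The finite word `x ↾ [a, a + n)`. -/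
def segment (x : ℤ → Γ) (a : ℤ) (n : ℕ) : List Γ := List.ofFn fun i : Fin n => x (a + (i : ℕ))

/-- A collection of words is uniquely readable if `uv = pws` with `u, v, w` in the collection
forces `p` or `s` to be empty. -/
def UniquelyReadable (V : Set (List Γ)) : Prop :=
  ∀ u ∈ V, ∀ v ∈ V, ∀ w ∈ V, ∀ p s : List Γ, u ++ v = p ++ w ++ s → p = [] ∨ s = []

/-- The symbolic shift `𝕂` of a construction sequence `W`: all `x` each of whose finite contiguous
subwords occurs inside some word of some `W m`. -/
def symbolicShift (W : ℕ → Set (List Γ)) : Set (ℤ → Γ) :=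
  {x | ∀ (a : ℤ) (n : ℕ), ∃ m, ∃ w ∈ W m, segment x a n <:+: w}

/-- The set `S ⊆ 𝕂` of those `x` for which there are `a_m, b_m → ∞` such that every
`x ↾ [-a_m, b_m)` is a word of some `W n`. -/
def fullSet (W : ℕ → Set (List Γ)) : Set (ℤ → Γ) :=
  {x | x ∈ symbolicShift W ∧ ∃ a b : ℕ → ℕ, Tendsto a atTop atTop ∧ Tendsto b atTop atTop ∧
    ∀ m, ∃ n, segment x (-(a m : ℤ)) (a m + b m) ∈ W n}

theorem shiftZ_shiftZ (a a' : ℤ) (x : ℤ → Γ) : shiftZ a (shiftZ a' x) = shiftZ (a + a') x := by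
  funext i
  simp only [shiftZ]
  congr 1
  ring

theorem shiftZ_zero (x : ℤ → Γ) : shiftZ 0 x = x := by
  funext i
  simp [shiftZ]

end Symbolic

/-! ### Circular coefficient sequences and circular words -/

/-- A circular coefficient sequence `⟨k_n, l_n⟩`. -/
structure CoeffSeq where
  k : ℕ → ℕ
  l : ℕ → ℕ
  two_le_k : ∀ n, 2 ≤ k n
  l_pos : ∀ n, 0 < l n
  summable_inv_l : Summable fun n => (1 : ℝ) / (l n : ℝ)

namespace CoeffSeq

variable (c : CoeffSeq)

/-- The pair `(p_n, q_n)`: `(p_0, q_0) = (0, 1)`, `p_{n+1} = p_n q_n k_n l_n + 1`,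
`q_{n+1} = k_n l_n q_n ^ 2`. -/
def pq : ℕ → ℕ × ℕ
  | 0 => (0, 1)
  | n + 1 => ((pq n).1 * (pq n).2 * c.k n * c.l n + 1, c.k n * c.l n * (pq n).2 ^ 2)

/-- The numerators `p_n`. -/
def p (n : ℕ) : ℕ := (c.pq n).1

/-- The denominators (and word lengths) `q_n`. -/
def q (n : ℕ) : ℕ := (c.pq n).2

end CoeffSeq

/-- The number `j_i` with `0 ≤ j_i < q` and `j_i ≡ p⁻¹ i` modulo `q`. -/
def jj (p q i : ℕ) : ℕ := ((p : ZMod q)⁻¹ * (i : ZMod q)).val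

/-- The alphabet `Σ ∪ {b, e}`. -/
inductive Sym (A : Type*) where
  | letter (a : A) : Sym A
  | b : Sym A
  | e : Sym A

/-- The alphabet carries the discrete topology. -/
instance (A : Type*) : TopologicalSpace (Sym A) := ⊥

instance (A : Type*) : DiscreteTopology (Sym A) := ⟨rfl⟩

/-- Every set of symbols is measurable. -/
instance (A : Type*) : MeasurableSpace (Sym A) := ⊤

section Words

variable {A : Type*}

/-- The circular operator
`𝒞(w_0, …, w_{k-1}) = ∏_{i < q} ∏_{j < k} b^{q - j_i} w_j^{l - 1} e^{j_i}`. -/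
def circ (p q k l : ℕ) (w : Fin k → List (Sym A)) : List (Sym A) :=
  (List.ofFn fun i : Fin q => (List.ofFn fun j : Fin k =>
    List.replicate (q - jj p q i) Sym.b ++ (List.replicate (l - 1) (w j)).flatten ++
      List.replicate (jj p q i) Sym.e).flatten).flatten

variable (c : CoeffSeq)

/-- The operator `𝒞` with the parameters of stage `n`. -/
def CoeffSeq.circ (c : CoeffSeq) (n : ℕ) (w : Fin (c.k n) → List (Sym A)) : List (Sym A) :=
  Circular.circ (c.p n) (c.q n) (c.k n) (c.l n) w

/-- The word collections built from the prewords `P n` (the set usually denoted `P_{n+1}`):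
`W_0 = Σ` and `W_{n+1} = {𝒞(w_0, …, w_{k_n - 1}) : (w_0, …, w_{k_n - 1}) ∈ P n}`. -/
def words (P : ∀ n, Set (Fin (c.k n) → List (Sym A))) : ℕ → Set (List (Sym A))
  | 0 => Set.range fun a => [Sym.letter a]
  | n + 1 => c.circ n '' P n

/-- The prewords `P` define a circular construction sequence. The remaining clause in the
definition of a construction sequence (the proportion of spacers in words of stage `n + 1` is
bounded by a summable sequence) is automatic, as this proportion is `1 / l_n`. -/
structure IsCircular (P : ∀ n, Set (Fin (c.k n) → List (Sym A))) : Prop where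
  /-- prewords of stage `n` are elements of `(W_n)^{k_n}` -/
  mem_words : ∀ n, ∀ v ∈ P n, ∀ j, v j ∈ words c P n
  /-- every `n`-word occurs in every `(n+1)`-word -/
  occurs : ∀ n, ∀ w ∈ words c P n, ∀ w' ∈ words c P (n + 1), w <:+: w'
  /-- strong unique readability: the prewords, as words in the alphabet `W_n`, are uniquely
  readable -/
  readable : ∀ n, UniquelyReadable (List.ofFn '' P n)

/-- The number `f(w, w')` of occurrences of the word `w` among the `n`-subwords `w_j` displayed in
`w' = 𝒞(v_0, …, v_{k_n - 1}) = ∏_{i < q_n} ∏_{j < k_n} b^{q_n - j_i} v_j^{l_n - 1} e^{j_i}`. -/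
noncomputable def occurrences (n : ℕ) (w : List (Sym A)) (v : Fin (c.k n) → List (Sym A)) : ℕ :=
  Nat.card {x : Fin (c.q n) × Fin (c.k n) × Fin (c.l n - 1) // v x.2.1 = w}

/-- Uniformity of the construction sequence:
`|f(w, w') / (q_{n+1} / q_n) - d_n(w)| < δ_{n+1} / q_n` for some `d_n : W_n → (0, 1)` and some
summable sequence `δ` of positive numbers. -/
def IsUniform (P : ∀ n, Set (Fin (c.k n) → List (Sym A))) : Prop :=
  ∃ δ : ℕ → ℝ, (∀ n, 0 < δ n) ∧ Summable δ ∧ ∃ d : ℕ → List (Sym A) → ℝ,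
    ∀ n, ∀ w ∈ words c P n, d n w ∈ Set.Ioo (0 : ℝ) 1 ∧ ∀ v ∈ P n,
      |(occurrences c n w v : ℝ) / ((c.q (n + 1) : ℝ) / (c.q n : ℝ)) - d n w|
        < δ (n + 1) / (c.q n : ℝ)

end Words

/-! ### The circle factor `𝒦` -/

section CircleFactor

variable (c : CoeffSeq)

/-- The unique `n`-word `w_n^α` of the circle factor, over the alphabet `{*} ∪ {b, e}`. -/
def circleWord : ℕ → List (Sym Unit)
  | 0 => [Sym.letter ()]
  | n + 1 => c.circ n fun _ => circleWord n

/-- The set `S` of the circle factor `𝒦`. -/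
def circleFullSet : Set (ℤ → Sym Unit) := fullSet fun n => {circleWord c n}

/-- The map `Σ ∪ {b, e} → {*} ∪ {b, e}` that forgets letters. -/
def forget {A : Type*} : Sym A → Sym Unit
  | Sym.letter _ => Sym.letter ()
  | Sym.b => Sym.b
  | Sym.e => Sym.e

/-- The canonical factor map `π : 𝕂ᶜ → 𝒦`. -/
def circleProj {A : Type*} (x : ℤ → Sym A) : ℤ → Sym Unit := fun i => forget (x i)

/-- `[-r, q_n - r)` is a principal `n`-block of `s`. -/
def IsLocation (n : ℕ) (s : ℤ → Sym Unit) (r : ℕ) : Prop :=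
  r < c.q n ∧ segment s (-(r : ℤ)) (c.q n) = circleWord c n

/-- `s` has a principal `n`-block. -/
def HasBlock (n : ℕ) (s : ℤ → Sym Unit) : Prop := ∃ r, IsLocation c n s r

/-- The location `r_n(s)` of `0` in the principal `n`-block of `s` (only used when there is
one). -/
noncomputable def loc (n : ℕ) (s : ℤ → Sym Unit) : ℕ := sInf {r | IsLocation c n s r}

/-! For a position `r` in an `(n+1)`-word `∏_{i < q} ∏_{j < k} b^{q - j_i} w_j^{l - 1} e^{j_i}`, the
2-subsections have length `k l q` and the 1-subsections have length `l q`. -/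

/-- The index `i` of the 2-subsection containing position `r` of an `(n+1)`-word. -/
def sub2 (n r : ℕ) : ℕ := r / (c.k n * c.l n * c.q n)

/-- The index `j` (in its 2-subsection) of the 1-subsection containing position `r` of an
`(n+1)`-word; so position `r` belongs to the `j`-th argument of `𝒞`. -/
def sub1 (n r : ℕ) : ℕ := r % (c.k n * c.l n * c.q n) / (c.l n * c.q n)

/-- The number `q_n - j_i` of symbols `b` at the start of the 1-subsection containing position `r`
of an `(n+1)`-word. -/
def leadB (n r : ℕ) : ℕ := c.q n - jj (c.p n) (c.q n) (sub2 c n r)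

/-- Position `r` of an `(n+1)`-word is in its interior, i.e. in one of the powers
`w_j^{l_n - 1}`. -/
def IsInterior (n r : ℕ) : Prop :=
  leadB c n r ≤ r % (c.l n * c.q n) ∧
    r % (c.l n * c.q n) < leadB c n r + (c.l n - 1) * c.q n

/-- For an interior position `r` of an `(n+1)`-word: the index (from `0` to `l_n - 2`) of the copy
of `w_j` in the power `w_j^{l_n - 1}` that contains position `r`. -/
def copyIdx (n r : ℕ) : ℕ := (r % (c.l n * c.q n) - leadB c n r) / c.q n

/-- Position `r` of an `n`-word is in its boundary. -/
def InBoundary : ℕ → ℕ → Prop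
  | 0, _ => False
  | n + 1, r => ¬ IsInterior c n r

/-- `0` lies in a principal `(n+1)`-block of `s`, at an interior position of it. -/
def HasArg (n : ℕ) (s : ℤ → Sym Unit) : Prop :=
  HasBlock c (n + 1) s ∧ IsInterior c n (loc c (n + 1) s)

/-- The index `j` such that the principal `n`-block of `s` arises from the `j`-th argument of
`𝒞(w_n^α, …, w_n^α)`. -/
noncomputable def argIdx (n : ℕ) (s : ℤ → Sym Unit) : ℕ := sub1 c n (loc c (n + 1) s)

/-- `E_n`: there is no principal `n`-block, or `0` is in the boundary of it. -/
def setE (n : ℕ) : Set (ℤ → Sym Unit) := {s | ¬ HasBlock c n s ∨ InBoundary c n (loc c n s)}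

/-- `E_n^0`: `0` is in the first or last `ε_n l_n` copies of `w` in a power `w^{l_n - 1}`. -/
def setE0 (ε : ℕ → ℝ) (n : ℕ) : Set (ℤ → Sym Unit) :=
  {s | HasArg c n s ∧
    (((copyIdx c n (loc c (n + 1) s) : ℝ) + 1 ≤ ε n * c.l n) ∨
      ((c.l n : ℝ) - 1 - copyIdx c n (loc c (n + 1) s) ≤ ε n * c.l n))}

/-- `E_n^1`: `0` is in the first or last `ε_n k_n` 1-subsections of its 2-subsection. -/
def setE1 (ε : ℕ → ℝ) (n : ℕ) : Set (ℤ → Sym Unit) :=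
  {s | HasBlock c (n + 1) s ∧
    (((sub1 c n (loc c (n + 1) s) : ℝ) + 1 ≤ ε n * c.k n) ∨
      ((c.k n : ℝ) - sub1 c n (loc c (n + 1) s) ≤ ε n * c.k n))}

/-- `E_n^2`: `0` is in the first or last `ε_n q_n` 2-subsections of its principal
`(n+1)`-block. -/
def setE2 (ε : ℕ → ℝ) (n : ℕ) : Set (ℤ → Sym Unit) :=
  {s | HasBlock c (n + 1) s ∧
    (((sub2 c n (loc c (n + 1) s) : ℝ) + 1 ≤ ε n * c.q n) ∨
      ((c.q n : ℝ) - sub2 c n (loc c (n + 1) s) ≤ ε n * c.q n))}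

/-- `n` is mature for `s`. -/
def IsMature (ε : ℕ → ℝ) (n : ℕ) (s : ℤ → Sym Unit) : Prop :=
  ∀ m, n ≤ m → s ∉ setE c m ∪ setE0 c ε m ∪ setE1 c ε m ∪ setE2 c ε m

/-- The sequences `ε` used to define maturity: decreasing, with values in `[0, 1)`, and
`ε_N > ∑_{n > N} ε_n`. -/
structure IsMaturitySeq (ε : ℕ → ℝ) : Prop where
  antitone : Antitone ε
  mem_Ico : ∀ n, ε n ∈ Set.Ico (0 : ℝ) 1
  summable : Summable ε
  tail_lt : ∀ N, ∑' n, ε (N + 1 + n) < ε N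

/-! ### Rotations of the circle factor -/

/-- `ρ_n(s) = i / q_n` in `ℝ / ℤ`, where `i ≡ p_n r_n(s)` modulo `q_n`. -/
noncomputable def rho (n : ℕ) (s : ℤ → Sym Unit) : UnitAddCircle :=
  (((c.p n : ℝ) * (loc c n s : ℝ) / (c.q n : ℝ) : ℝ) : UnitAddCircle)

/-- `φ_0(s) = x`, where `φ_0 = lim ρ_n` is the isomorphism from `𝒦` to the circle `ℝ / ℤ` with
the rotation by `α = lim p_n / q_n`. -/
def IsCircleCoord (s : ℤ → Sym Unit) (x : UnitAddCircle) : Prop :=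
  Tendsto (fun n => rho c n s) atTop (𝓝 x)

/-- `t = 𝒮_β(s)`, where `𝒮_β = φ_0⁻¹ ∘ ℛ_β ∘ φ_0`: both points are in the set `S` of `𝒦`, on which
`φ_0` is injective, and `φ_0(t) = φ_0(s) + β`. -/
def IsRotation (β : UnitAddCircle) (s t : ℤ → Sym Unit) : Prop :=
  s ∈ circleFullSet c ∧ t ∈ circleFullSet c ∧
    ∃ x, IsCircleCoord c s x ∧ IsCircleCoord c t (x + β)

/-! ### The displacement function -/

/-- The number `d^n(s) ∈ {0, …, q_n - 1}` with `d^n(s) ≡ r_n(t) - r_n(s)` modulo `q_n`, where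
`t = 𝒮_β(s)` (only used when `n` is mature for `s` and `r_n(t)` is defined). -/
noncomputable def displacement (n : ℕ) (s t : ℤ → Sym Unit) : ℤ :=
  ((loc c n t : ℤ) - (loc c n s : ℤ)) % (c.q n : ℤ)

/-- `s` is ill-`β`-matched at stage `n`: `n` is mature for `s`, and the principal `n`-blocks of
`T^{d^{n+1}(s) - d^n(s)} s` and of `s` arise from different arguments of
`𝒞(w_n^α, …, w_n^α)`. -/
def IllMatched (ε : ℕ → ℝ) (β : UnitAddCircle) (n : ℕ) (s : ℤ → Sym Unit) : Prop :=
  IsMature c ε n s ∧ ∃ t, IsRotation c β s t ∧ HasBlock c n t ∧ HasBlock c (n + 1) t ∧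
    HasArg c n (shiftZ (displacement c (n + 1) s t - displacement c n s t) s) ∧
    argIdx c n (shiftZ (displacement c (n + 1) s t - displacement c n s t) s) ≠ argIdx c n s

/-- `Δ(β) = ∑_n Δ_n(β)`, where `Δ_n(β)` is the measure of the set of points that are
ill-`β`-matched at stage `n`. -/
noncomputable def Delta {A : Type*} (ε : ℕ → ℝ) (ν : Measure (ℤ → Sym A)) (β : UnitAddCircle) :
    ENNReal :=
  ∑' n, ν {s | IllMatched c ε β n (circleProj s)}

/-- `β` is a central value. -/
def IsCentral {A : Type*} (ε : ℕ → ℝ) (ν : Measure (ℤ → Sym A)) (β : UnitAddCircle) : Prop :=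
  Delta c ε ν β < ⊤

end CircleFactor

/-! ### Measure preserving transformations and the weak topology -/

section MPT

/-- The invertible measure preserving transformations of `(X, ν)`; inverses are required up to
null sets. The members of an a.e.-equality class are not identified with each other, but they are
topologically indistinguishable in the weak topology below. -/
structure MPT {X : Type*} [MeasurableSpace X] (ν : Measure X) where
  toFun : X → X
  measurePreserving : MeasurePreserving toFun ν ν
  exists_inv : ∃ g : X → X, MeasurePreserving g ν ν ∧ (∀ᵐ x ∂ν, g (toFun x) = x) ∧
    ∀ᵐ x ∂ν, toFun (g x) = x

variable {X : Type*} [MeasurableSpace X] {ν : Measure X}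

/-- The Koopman operator `f ↦ f ∘ T` on `L²(ν)`. -/
noncomputable def MPT.koopman (T : MPT ν) : Lp ℂ 2 ν →L[ℂ] Lp ℂ 2 ν :=
  (Lp.compMeasurePreservingₗᵢ ℂ T.toFun T.measurePreserving).toContinuousLinearMap

/-- The weak topology: the topology induced by the weak operator topology on Koopman operators. -/
noncomputable instance : TopologicalSpace (MPT ν) :=
  TopologicalSpace.induced
    (fun T : MPT ν => (ContinuousLinearMapWOT.ofCLM T.koopman : Lp ℂ 2 ν →WOT[ℂ] Lp ℂ 2 ν))
    inferInstance

/-- `S` belongs to the centralizer `C(T)`. -/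
def MPT.InCentralizer (T S : MPT ν) : Prop :=
  ∀ᵐ x ∂ν, S.toFun (T.toFun x) = T.toFun (S.toFun x)

end MPT

section ShiftPowers

variable {Γ : Type*} [MeasurableSpace Γ]

theorem measurable_shiftZ (a : ℤ) : Measurable (shiftZ a : (ℤ → Γ) → ℤ → Γ) :=
  measurable_pi_lambda _ fun i => measurable_pi_apply (i + a)

theorem measurePreserving_shiftZ {ν : Measure (ℤ → Γ)} (h : MeasurePreserving (shiftZ 1) ν ν)
    (a : ℤ) : MeasurePreserving (shiftZ a) ν ν := by
  have hn : MeasurePreserving (shiftZ (-1)) ν ν := by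
    refine ⟨measurable_shiftZ _, ?_⟩
    conv_lhs => rw [← h.map_eq]
    rw [Measure.map_map (measurable_shiftZ _) (measurable_shiftZ _)]
    have : (shiftZ (-1) ∘ shiftZ 1 : (ℤ → Γ) → ℤ → Γ) = id := by
      funext x
      simp [shiftZ_shiftZ, shiftZ_zero]
    rw [this, Measure.map_id]
  induction a using Int.induction_on with
  | zero =>
    have : (shiftZ 0 : (ℤ → Γ) → ℤ → Γ) = id := funext shiftZ_zero
    rw [this]
    exact MeasurePreserving.id ν
  | succ i ih =>
    have : (shiftZ ((i : ℤ) + 1) : (ℤ → Γ) → ℤ → Γ) = shiftZ (i : ℤ) ∘ shiftZ 1 := by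
      funext x
      simp [shiftZ_shiftZ]
    rw [this]
    exact ih.comp h
  | pred i ih =>
    have : (shiftZ (-(i : ℤ) - 1) : (ℤ → Γ) → ℤ → Γ) = shiftZ (-(i : ℤ)) ∘ shiftZ (-1) := by
      funext x
      simp [shiftZ_shiftZ, sub_eq_add_neg]
    rw [this]
    exact ih.comp hn

/-- The power `T^a` of the shift `T`, as a measure preserving transformation. -/
def shiftPow {ν : Measure (ℤ → Γ)} (h : MeasurePreserving (shiftZ 1) ν ν) (a : ℤ) : MPT ν where
  toFun := shiftZ a
  measurePreserving := measurePreserving_shiftZ h a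
  exists_inv := ⟨shiftZ (-a), measurePreserving_shiftZ h (-a),
    Eventually.of_forall fun x => by simp [shiftZ_shiftZ, shiftZ_zero],
    Eventually.of_forall fun x => by simp [shiftZ_shiftZ, shiftZ_zero]⟩

end ShiftPowers

/-- `φ^π = 𝒮_β`: the map `φ` of `𝕂ᶜ` projects to the rotation `𝒮_β` of the circle factor, that is,
`π ∘ φ = 𝒮_β ∘ π` almost everywhere. -/
def HasRotationFactor (c : CoeffSeq) {A : Type*} {ν : Measure (ℤ → Sym A)} (φ : MPT ν)
    (β : UnitAddCircle) : Prop :=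
  ∀ᵐ s ∂ν, IsRotation c β (circleProj s) (circleProj (φ.toFun s))

end Circular

namespace Circular

/-! ### Positions in words -/

/-! Represent β by a real b ≥ 0 and let a_n = `rotationShift c b n`, the residue modulo q_n with p_n
a_n ≡ ⌊b q_n⌋. The residue of p_n r modulo q_n lists the locations r of an n-word in their order
along the circle, and by `mul_mod_succ` passing to stage n+1 cuts each of the q_n arcs into k_n l_n
q_n arcs. So a typical s has a coordinate x with p_n r_n ≡ ⌊x q_n⌋ (`exists_coordinate`), and its
rotate has locations r'_n with p_n r'_n ≡ ⌊(x + b) q_n⌋. The floor of a sum is the sum of the floors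
or one more, so r_n + a_n is, modulo q_n, either r'_n or the location of the arc just before it.
Away from the ends of 1-subsections such neighbours have the same argument index and the same
location one stage below (`adjacent_of_isSafe`).

Translation by a_{n+1} < q_{n+1} keeps a well-placed point inside one power of its (n+1)-word. Hence
T^{a_{n+1}} s sees around 0, at location r'_n, the n-word standing in the argument to which r'_{n+1}
belongs. If s is not ill-matched at stage n, this is the argument of r_{n+1}
(`sub1_eq_of_not_illMatched`), so the n-word seen is the one s itself has around 0. When this holds
at all late stages, the translates stabilise on windows exhausting ℤ (`exists_tendsto_of_nested`),
and the limit projects to the rotate of π(s).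

Almost every s satisfies these conditions from some stage on, by Borel–Cantelli: centrality makes
the ill-matched sets summable, and badly placed locations have summable measure because each
location at stage n has measure at most 1/q_n (`ae_eventually_isGood`).

The rest is general. An a.e. limit F of powers T^{a_n} preserves ν and commutes with T. It is
invertible because T^{a_n} → F in measure forces a subsequence of T^{-a_n} to converge a.e.
(`exists_subseq_limit_neg`), with limit inverse to F (`limit_comp_limit`). Pointwise convergence
implies weak convergence (`tendsto_MPT_of_ae`). -/

theorem segment_eq_iff {Γ : Type*} {x : ℤ → Γ} {a : ℤ} {n : ℕ} {w : List Γ} (hw : w.length = n) :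
    segment x a n = w ↔ ∀ i < n, w[i]? = some (x (a + i)) := by
  subst hw
  constructor
  · intro h i hi
    rw [← h, segment, List.getElem?_ofFn]
    simp [hi]
  · intro h
    apply List.ext_getElem?
    intro i
    rw [segment, List.getElem?_ofFn]
    split
    · rename_i hi
      exact (h i hi).symm
    · rename_i hi
      exact (List.getElem?_eq_none (not_lt.1 hi)).symm

theorem length_segment {Γ : Type*} (x : ℤ → Γ) (a : ℤ) (n : ℕ) : (segment x a n).length = n := by
  simp [segment]

theorem segment_shiftZ {Γ : Type*} (x : ℤ → Γ) (a d : ℤ) (n : ℕ) :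
    segment (shiftZ d x) a n = segment x (a + d) n := by
  simp only [segment, shiftZ]
  congr 1
  funext i
  congr 1
  ring

theorem segment_map {Γ Γ' : Type*} (f : Γ → Γ') (x : ℤ → Γ) (a : ℤ) (n : ℕ) :
    segment (fun i => f (x i)) a n = (segment x a n).map f := by
  simp [segment, List.map_ofFn, Function.comp_def]

theorem length_flatten_ofFn {α : Type*} {n L : ℕ} (f : Fin n → List α)
    (hf : ∀ i, (f i).length = L) : (List.ofFn f).flatten.length = n * L := by
  induction n with
  | zero => simp
  | succ n ih =>
    rw [List.ofFn_succ, List.flatten_cons, List.length_append, ih _ fun i => hf _, hf]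
    ring

theorem getElem?_flatten_ofFn {α : Type*} {n L : ℕ} (f : Fin n → List α)
    (hf : ∀ i, (f i).length = L) {i : ℕ} (hi : i < n) {o : ℕ} (ho : o < L) :
    (List.ofFn f).flatten[i * L + o]? = (f ⟨i, hi⟩)[o]? := by
  induction n generalizing i with
  | zero => omega
  | succ n ih =>
    rw [List.ofFn_succ, List.flatten_cons]
    cases i with
    | zero =>
      rw [List.getElem?_append_left (by rw [hf]; omega)]
      simp
    | succ i =>
      rw [List.getElem?_append_right (by rw [hf]; nlinarith), hf]
      have : (i + 1) * L + o - L = i * L + o := by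
        rw [Nat.sub_eq_iff_eq_add (by nlinarith)]; ring
      rw [this, ih _ (fun i => hf _) (by omega)]
      rfl

/-! ### The symbols of a circular word, addressed by 2-subsection, 1-subsection and offset -/

section Circ

variable {A : Type*} {p q k l : ℕ} {w : Fin k → List (Sym A)}

theorem jj_lt (hq : 0 < q) (i : ℕ) : jj p q i < q := by
  have : NeZero q := ⟨hq.ne'⟩
  exact ZMod.val_lt _

theorem jj_zero : jj p q 0 = 0 := by simp [jj]

theorem length_oneSubsection (hl : 0 < l) {L j : ℕ} (hj : j < q) {u : List (Sym A)}
    (hu : u.length = q) (hL : L = l * q) :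
    (List.replicate (q - j) Sym.b ++ (List.replicate (l - 1) u).flatten ++
      List.replicate j Sym.e).length = L := by
  obtain ⟨l, rfl⟩ : ∃ m, l = m + 1 := ⟨l - 1, by omega⟩
  simp only [List.length_append, List.length_replicate, List.length_flatten, List.map_replicate,
    List.sum_replicate, hu, hL, smul_eq_mul, Nat.add_sub_cancel]
  rw [add_mul]
  omega

theorem length_circ (hq : 0 < q) (hl : 0 < l) (hw : ∀ j, (w j).length = q) :
    (circ p q k l w).length = k * l * q ^ 2 := by
  unfold circ
  rw [length_flatten_ofFn (L := k * (l * q))]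
  · ring
  · intro i
    rw [length_flatten_ofFn (L := l * q)]
    intro j
    exact length_oneSubsection hl (jj_lt hq _) (hw j) rfl

theorem getElem?_circ (hq : 0 < q) (hl : 0 < l) (hw : ∀ j, (w j).length = q) {i j o : ℕ}
    (hi : i < q) (hj : j < k) (ho : o < l * q) :
    (circ p q k l w)[i * (k * (l * q)) + (j * (l * q) + o)]? =
      (List.replicate (q - jj p q i) Sym.b ++ (List.replicate (l - 1) (w ⟨j, hj⟩)).flatten ++
      List.replicate (jj p q i) Sym.e)[o]? := by
  have h1 : ∀ (i : Fin q) (j : Fin k), (List.replicate (q - jj p q i) Sym.b ++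
      (List.replicate (l - 1) (w j)).flatten ++ List.replicate (jj p q i) Sym.e).length = l * q :=
    fun i j => length_oneSubsection hl (jj_lt hq _) (hw j) rfl
  unfold circ
  rw [getElem?_flatten_ofFn (L := k * (l * q)) _ _ hi,
    getElem?_flatten_ofFn (L := l * q) _ (h1 _) hj ho]
  · calc j * (l * q) + o < j * (l * q) + l * q := by omega
      _ = (j + 1) * (l * q) := by ring
      _ ≤ k * (l * q) := Nat.mul_le_mul_right _ hj
  · intro i
    exact length_flatten_ofFn _ (h1 i)

theorem getElem?_circ_b (hq : 0 < q) (hl : 0 < l) (hw : ∀ j, (w j).length = q) {i j o : ℕ}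
    (hi : i < q) (hj : j < k) (ho : o < q - jj p q i) :
    (circ p q k l w)[i * (k * (l * q)) + (j * (l * q) + o)]? = some Sym.b := by
  rw [getElem?_circ hq hl hw hi hj (by nlinarith [Nat.sub_le q (jj p q i)]), List.append_assoc,
    List.getElem?_append_left (by simpa using ho)]
  simp [ho]

theorem getElem?_circ_word (hq : 0 < q) (hl : 0 < l) (hw : ∀ j, (w j).length = q) {i j t u : ℕ}
    (hi : i < q) (hj : j < k) (ht : t < l - 1) (hu : u < q) :
    (circ p q k l w)[i * (k * (l * q)) + (j * (l * q) + (q - jj p q i + (t * q + u)))]? =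
      (w ⟨j, hj⟩)[u]? := by
  have hjj := jj_lt (p := p) hq i
  have hlen : (List.replicate (l - 1) (w ⟨j, hj⟩)).flatten.length = (l - 1) * q := by
    rw [← List.ofFn_const, length_flatten_ofFn _ fun _ => hw _]
  have h1 : t * q + u < (l - 1) * q := by nlinarith
  have h2 : (l - 1) * q + q = l * q := by
    obtain ⟨l, rfl⟩ : ∃ m, l = m + 1 := ⟨l - 1, by omega⟩
    simp; ring
  rw [getElem?_circ hq hl hw hi hj (by omega), List.append_assoc,
    List.getElem?_append_right (by simp), List.getElem?_append_left (by simpa [hlen] using h1)]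
  simp only [List.length_replicate, Nat.add_sub_cancel_left]
  rw [← List.ofFn_const, getElem?_flatten_ofFn _ (fun _ => hw _) ht hu]

theorem getElem?_circ_e (hq : 0 < q) (hl : 0 < l) (hw : ∀ j, (w j).length = q) {i j o : ℕ}
    (hi : i < q) (hj : j < k) (ho : q - jj p q i + (l - 1) * q ≤ o) (ho' : o < l * q) :
    (circ p q k l w)[i * (k * (l * q)) + (j * (l * q) + o)]? = some Sym.e := by
  have hlen : (List.replicate (l - 1) (w ⟨j, hj⟩)).flatten.length = (l - 1) * q := by
    rw [← List.ofFn_const, length_flatten_ofFn _ fun _ => hw _]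
  have h2 : (l - 1) * q + q = l * q := by
    obtain ⟨l, rfl⟩ : ∃ m, l = m + 1 := ⟨l - 1, by omega⟩
    simp; ring
  have hjj := jj_lt (p := p) hq i
  rw [getElem?_circ hq hl hw hi hj ho',
    List.getElem?_append_right (by simpa [hlen] using ho)]
  simp only [List.length_append, List.length_replicate, hlen, List.getElem?_replicate]
  rw [if_pos (by omega)]

end Circ

/-! ### Arithmetic of p_n, q_n and j_i -/

section Basic

variable (c : CoeffSeq)

theorem CoeffSeq.q_zero : c.q 0 = 1 := rfl

theorem CoeffSeq.q_succ (n : ℕ) : c.q (n + 1) = c.k n * c.l n * c.q n ^ 2 := rfl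

theorem CoeffSeq.p_succ (n : ℕ) : c.p (n + 1) = c.p n * c.q n * c.k n * c.l n + 1 := rfl

theorem CoeffSeq.k_pos (n : ℕ) : 0 < c.k n := by have := c.two_le_k n; omega

theorem CoeffSeq.q_pos (n : ℕ) : 0 < c.q n := by
  induction n with
  | zero => exact Nat.one_pos
  | succ n ih =>
    rw [c.q_succ]
    have := c.k_pos n
    have := c.l_pos n
    positivity

/-- p_{n+1} is one more than a common multiple of k_n, l_n and q_n, the factors of q_{n+1}. -/
theorem CoeffSeq.coprime (n : ℕ) : (c.p n).Coprime (c.q n) := by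
  cases n with
  | zero => exact Nat.coprime_one_right _
  | succ n =>
    rw [c.q_succ, c.p_succ]
    have h : ∀ d, d ∣ c.p n * c.q n * c.k n * c.l n →
        (c.p n * c.q n * c.k n * c.l n + 1).Coprime d := by
      rintro d ⟨m, hm⟩
      rw [hm, Nat.coprime_comm]
      simp
    have hq := h (c.q n) ⟨c.p n * c.k n * c.l n, by ring⟩
    exact ((h _ ⟨c.p n * c.q n * c.l n, by ring⟩).mul_right
      (h _ ⟨c.p n * c.q n * c.k n, by ring⟩)).mul_right (hq.pow_right 2)

theorem length_coeffCirc {A : Type*} (n : ℕ) {w : Fin (c.k n) → List (Sym A)}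
    (hw : ∀ j, (w j).length = c.q n) : (c.circ n w).length = c.q (n + 1) :=
  length_circ (c.q_pos n) (c.l_pos n) hw

theorem length_circleWord (n : ℕ) : (circleWord c n).length = c.q n := by
  induction n with
  | zero => rfl
  | succ n ih => exact length_coeffCirc c n fun _ => ih

theorem mul_jj (n i : ℕ) : ((c.p n : ZMod (c.q n)) * (jj (c.p n) (c.q n) i : ℕ)) = i := by
  have : NeZero (c.q n) := ⟨(c.q_pos n).ne'⟩
  rw [jj, ZMod.natCast_val, ZMod.cast_id', id, ← mul_assoc, ZMod.coe_mul_inv_eq_one _ (c.coprime n),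
    one_mul]

theorem isUnit_p (n : ℕ) : IsUnit (c.p n : ZMod (c.q n)) :=
  (ZMod.isUnit_iff_coprime _ _).2 (c.coprime n)

/-- Only the initial 2-subsection has 1-subsections beginning with a full b^{q_n}; this is what
makes the start of a block recognisable. -/
theorem eq_zero_of_jj_eq_zero {n i : ℕ} (hi : i < c.q n) (h : jj (c.p n) (c.q n) i = 0) :
    i = 0 := by
  have := mul_jj c n i
  rw [h, Nat.cast_zero, mul_zero] at this
  exact Nat.eq_zero_of_dvd_of_lt ((ZMod.natCast_eq_zero_iff _ _).1 this.symm) hi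

end Basic

/-! ### Uniqueness of principal blocks -/

section Unique

variable (c : CoeffSeq)

theorem exists_position (n : ℕ) {u : ℕ} (hu : u < c.q (n + 1)) : ∃ i < c.q n, ∃ j < c.k n,
    ∃ o < c.l n * c.q n, u = i * (c.k n * (c.l n * c.q n)) + (j * (c.l n * c.q n) + o) := by
  have hq := c.q_pos n
  have hl := c.l_pos n
  have hk := c.k_pos n
  have hlq : 0 < c.l n * c.q n := by positivity
  refine ⟨u / (c.k n * (c.l n * c.q n)), ?_, u % (c.k n * (c.l n * c.q n)) / (c.l n * c.q n), ?_,
    u % (c.k n * (c.l n * c.q n)) % (c.l n * c.q n), Nat.mod_lt _ hlq, ?_⟩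
  · rw [Nat.div_lt_iff_lt_mul (by positivity)]
    rw [c.q_succ] at hu
    linarith
  · rw [Nat.div_lt_iff_lt_mul hlq]
    exact Nat.mod_lt _ (by positivity)
  · rw [Nat.div_add_mod', Nat.div_add_mod']

/-- The length of the initial run of the symbol `b` in the word `w_n^α`. -/
def initialRun : ℕ → ℕ
  | 0 => 0
  | n + 1 => c.q n + initialRun n

variable {c}

theorem pred_mul_add {l q : ℕ} (hl : 0 < l) : (l - 1) * q + q = l * q := by
  obtain ⟨l, rfl⟩ : ∃ m, l = m + 1 := ⟨l - 1, by omega⟩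
  simp; ring

/-- Since j_0 = 0, the word of stage n+1 begins with b^{q_n} followed by the word of stage n, so the
initial runs add up. The last clause bounds runs of b that start inside a copy of the word. -/
theorem initialRun_spec (hl : ∀ n, 2 ≤ c.l n) (n : ℕ) :
    (∀ v < initialRun c n, (circleWord c n)[v]? = some Sym.b) ∧
    (∃ s, (circleWord c n)[initialRun c n]? = some s ∧ s ≠ Sym.b) ∧
    ∃ s, (circleWord c n)[c.q n - 1]? = some s ∧ s ≠ Sym.b := by
  induction n with
  | zero => simp [initialRun, circleWord, c.q_zero]
  | succ n ih =>
    obtain ⟨ih1, ⟨s, ih2, hs⟩, s', ih3, hs'⟩ := ih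
    have hq := c.q_pos n
    have hk := c.k_pos n
    have hln := hl n
    have hw : ∀ j : Fin (c.k n), (circleWord c n).length = c.q n := fun _ => length_circleWord c n
    have hI : initialRun c n < c.q n := by
      by_contra h
      rw [List.getElem?_eq_none (by rw [length_circleWord]; omega)] at ih2
      cases ih2
    have hword : ∀ u < c.q n, (circleWord c (n + 1))[c.q n + u]? = (circleWord c n)[u]? := by
      intro u hu
      have := getElem?_circ_word (p := c.p n) (t := 0) hq (by omega : 0 < c.l n) hw hq hk
        (by omega) hu
      simp [jj_zero] at this
      exact this
    refine ⟨fun v hv => ?_, ⟨s, ?_, hs⟩, ?_⟩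
    · rcases lt_or_ge v (c.q n) with h | h
      · have := getElem?_circ_b (p := c.p n) (o := v) hq (by omega : 0 < c.l n) hw hq hk
          (by simpa [jj_zero] using h)
        simp at this
        exact this
      · obtain ⟨v, rfl⟩ := Nat.exists_eq_add_of_le h
        simp only [initialRun] at hv
        rw [hword v (by omega), ih1 v (by omega)]
    · rw [initialRun, hword _ hI, ih2]
    · have hjq := jj_lt (p := c.p n) hq (c.q n - 1)
      have h2 := pred_mul_add (q := c.q n) (by omega : 0 < c.l n)
      have hpos : c.q (n + 1) - 1 = (c.q n - 1) * (c.k n * (c.l n * c.q n)) +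
          ((c.k n - 1) * (c.l n * c.q n) + (c.l n * c.q n - 1)) := by
        have e1 := pred_mul_add (q := c.k n * (c.l n * c.q n)) hq
        have e2 := pred_mul_add (q := c.l n * c.q n) hk
        have e3 : c.q (n + 1) = c.q n * (c.k n * (c.l n * c.q n)) := by rw [c.q_succ]; ring
        have : 0 < c.l n * c.q n := by positivity
        omega
      have hlq : 0 < c.l n * c.q n := by positivity
      -- The word ends with spacers e unless the last j_i vanishes, which happens only for q_n = 1;
      -- then it ends with a copy of the word of stage n.
      rcases Nat.eq_zero_or_pos (jj (c.p n) (c.q n) (c.q n - 1)) with h0 | h0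
      · refine ⟨s', ?_, hs'⟩
        have := getElem?_circ_word (p := c.p n) (t := c.l n - 2) (u := c.q n - 1) hq
          (by omega : 0 < c.l n) hw (by omega : c.q n - 1 < c.q n) (by omega : c.k n - 1 < c.k n)
          (by omega) (by omega)
        rw [← ih3, hpos, ← this]
        have h3 : (c.l n - 2) * c.q n + c.q n = (c.l n - 1) * c.q n := by
          rw [← pred_mul_add (by omega : 0 < c.l n - 1)]; rfl
        have h4 : c.l n * c.q n - 1 =
          c.q n - jj (c.p n) (c.q n) (c.q n - 1) + ((c.l n - 2) * c.q n + (c.q n - 1)) := by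
          omega
        rw [h4]
        rfl
      · refine ⟨Sym.e, ?_, by simp⟩
        rw [hpos]
        exact getElem?_circ_e (p := c.p n) hq (by omega : 0 < c.l n) hw
          (by omega : c.q n - 1 < c.q n) (by omega : c.k n - 1 < c.k n) (by omega) (by omega)

theorem eq_of_segment {Γ : Type*} {x : ℤ → Γ} {a : ℤ} {n : ℕ} {w : List Γ} (hw : w.length = n)
    (h : segment x a n = w) {i : ℕ} {s : Γ} (hs : w[i]? = some s) : x (a + i) = s := by
  have hi : i < n := by
    by_contra hi
    rw [List.getElem?_eq_none (by omega)] at hs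
    cases hs
  have := (segment_eq_iff hw).1 h i hi
  rw [hs] at this
  exact (Option.some.inj this).symm

theorem run_of_segment (hl : ∀ n, 2 ≤ c.l n) {n : ℕ} {x : ℤ → Sym Unit} {a : ℤ}
    (hx : segment x a (c.q (n + 1)) = circleWord c (n + 1)) {j : ℕ} (hj : j < c.k n) {v : ℕ}
    (hv : v < initialRun c (n + 1)) : x (a + (j * (c.l n * c.q n) + v : ℕ)) = Sym.b := by
  have hq := c.q_pos n
  have hln := hl n
  apply eq_of_segment (length_circleWord c _) hx
  have hw : ∀ j : Fin (c.k n), (circleWord c n).length = c.q n := fun _ => length_circleWord c n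
  rcases lt_or_ge v (c.q n) with h | h
  · have := getElem?_circ_b (p := c.p n) (o := v) hq (by omega : 0 < c.l n) hw hq hj
      (by simpa [jj_zero] using h)
    simp at this
    exact this
  · obtain ⟨v, rfl⟩ := Nat.exists_eq_add_of_le h
    simp only [initialRun] at hv
    have hv' := (initialRun_spec hl n).1 v (by omega)
    have hvq : v < c.q n := by
      by_contra h
      rw [List.getElem?_eq_none (by rw [length_circleWord]; omega)] at hv'
      cases hv'
    have := getElem?_circ_word (p := c.p n) (t := 0) hq (by omega : 0 < c.l n) hw hq hj
        (by omega) hvq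
    rw [hv'] at this
    simp [jj_zero] at this
    exact this

/-- Converse of `run_of_segment`: a run of b of maximal length begins only at a 1-subsection of the
initial 2-subsection. Started in another group of b's or in the middle of one, it meets the first
non-b of the following copy too early; started inside a copy, it meets the last symbol of that copy.
-/
theorem position_of_run (hl : ∀ n, 2 ≤ c.l n) {n : ℕ} {x : ℤ → Sym Unit} {a : ℤ}
    (hx : segment x a (c.q (n + 1)) = circleWord c (n + 1)) {u : ℕ} (hu : u < c.q (n + 1))
    (hrun : ∀ v < initialRun c (n + 1), x (a + (u + v : ℕ)) = Sym.b) :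
    ∃ j < c.k n, u = j * (c.l n * c.q n) := by
  have hq := c.q_pos n
  have hln := hl n
  obtain ⟨i, hi, j, hj, o, ho, rfl⟩ := exists_position c n hu
  have hw : ∀ j : Fin (c.k n), (circleWord c n).length = c.q n := fun _ => length_circleWord c n
  obtain ⟨ih1, ⟨s, ih2, hs⟩, s', ih3, hs'⟩ := initialRun_spec hl n
  have hjq := jj_lt (p := c.p n) hq i
  have hI : initialRun c n < c.q n := by
    by_contra h
    rw [List.getElem?_eq_none (by rw [length_circleWord]; omega)] at ih2
    cases ih2
  have h2 := pred_mul_add (q := c.q n) (by omega : 0 < c.l n)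
  rcases lt_or_ge o (c.q n - jj (c.p n) (c.q n) i) with h | h
  · by_cases h0 : o = 0 ∧ jj (c.p n) (c.q n) i = 0
    · refine ⟨j, hj, ?_⟩
      rw [h0.1, eq_zero_of_jj_eq_zero c hi h0.2]
      ring
    · exfalso
      have h3 := eq_of_segment (length_circleWord c _) hx (ih2 ▸ getElem?_circ_word (p := c.p n)
        (t := 0) hq (by omega : 0 < c.l n) hw hi hj (by omega) hI)
      have h4 := hrun (c.q n - jj (c.p n) (c.q n) i + initialRun c n - o)
        (by simp only [initialRun]; omega)
      apply hs
      rw [← h3, ← h4]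
      congr 2
      push_cast [Nat.cast_sub hjq.le]
      omega
  · exfalso
    rcases lt_or_ge o (c.q n - jj (c.p n) (c.q n) i + (c.l n - 1) * c.q n) with h' | h'
    · obtain ⟨o, rfl⟩ := Nat.exists_eq_add_of_le h
      have ht : o / c.q n < c.l n - 1 := by
        rw [Nat.div_lt_iff_lt_mul hq]; omega
      have h3 := eq_of_segment (length_circleWord c _) hx (ih3 ▸ getElem?_circ_word (p := c.p n)
        (t := o / c.q n) hq (by omega : 0 < c.l n) hw hi hj ht (by omega : c.q n - 1 < c.q n))
      have h5 := Nat.mod_lt o hq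
      have h6 := Nat.div_add_mod' o (c.q n)
      have h4 := hrun (c.q n - 1 - o % c.q n) (by simp only [initialRun]; omega)
      apply hs'
      rw [← h3, ← h4]
      congr 2
      omega
    · have h3 := eq_of_segment (length_circleWord c _) hx (getElem?_circ_e (p := c.p n)
        hq (by omega : 0 < c.l n) hw hi hj h' ho)
      have h4 := hrun 0 (by simp only [initialRun]; omega)
      rw [add_zero, h3] at h4
      cases h4

theorem two_le_q (n : ℕ) : 2 ≤ c.q (n + 1) := by
  rw [c.q_succ]
  have h1 := c.two_le_k n
  have h2 := c.l_pos n
  have h3 := c.q_pos n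
  have : 1 ≤ c.l n * c.q n ^ 2 := Nat.one_le_iff_ne_zero.2 (by positivity)
  nlinarith

/-- The second block would begin at the j-th 1-subsection of the first, 0 < j < k. Its own last run
of the initial 2-subsection then sits at index j + k - 1 ≥ k, where the first block has no such run.
That position still lies in the first block because q_{n+1} ≥ 2, which is why blocks are unique only
from stage 2 on. -/
theorem not_segment_overlap (hl : ∀ n, 2 ≤ c.l n) {n : ℕ} {x : ℤ → Sym Unit} {a : ℤ} {h : ℕ}
    (hx : segment x a (c.q (n + 2)) = circleWord c (n + 2)) (h0 : 0 < h) (h1 : h < c.q (n + 2))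
    (hx' : segment x (a + h) (c.q (n + 2)) = circleWord c (n + 2)) : False := by
  have hq := two_le_q (c := c) n
  have hk := c.two_le_k (n + 1)
  have hln := hl (n + 1)
  obtain ⟨j, hj, rfl⟩ := position_of_run hl hx h1 fun v hv => by
    have := run_of_segment hl hx' (c.k_pos (n + 1)) hv
    rw [← this]
    push_cast
    ring_nf
  have hlq : 0 < c.l (n + 1) * c.q (n + 1) := by have := c.q_pos (n + 1); positivity
  have hj0 : 0 < j := by
    rcases Nat.eq_zero_or_pos j with rfl | h
    · simp at h0
    · exact h
  have hlt : (j + (c.k (n + 1) - 1)) * (c.l (n + 1) * c.q (n + 1)) < c.q (n + 2) := by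
    have : j + (c.k (n + 1) - 1) < c.q (n + 1) * c.k (n + 1) := by
      have := Nat.mul_le_mul_right (c.k (n + 1)) hq
      omega
    calc _ < (c.q (n + 1) * c.k (n + 1)) * (c.l (n + 1) * c.q (n + 1)) :=
          Nat.mul_lt_mul_of_pos_right this hlq
      _ = _ := by rw [c.q_succ (n + 1)]; ring
  obtain ⟨j', hj', h⟩ := position_of_run hl hx hlt fun v hv => by
    have := run_of_segment hl hx' (j := c.k (n + 1) - 1) (by omega) hv
    rw [← this]
    push_cast
    ring_nf
  have := Nat.eq_of_mul_eq_mul_right hlq h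
  omega

theorem isLocation_unique (hl : ∀ n, 2 ≤ c.l n) {n : ℕ} (hn : 2 ≤ n) {x : ℤ → Sym Unit} {r r' : ℕ}
    (h : IsLocation c n x r) (h' : IsLocation c n x r') : r = r' := by
  obtain ⟨n, rfl⟩ : ∃ m, n = m + 2 := ⟨n - 2, by omega⟩
  by_contra hne
  wlog hlt : r' < r generalizing r r'
  · exact this h' h (Ne.symm hne) (by omega)
  refine not_segment_overlap hl h.2 (h := r - r') (by omega) (by have := h.1; omega) ?_
  rw [← h'.2]
  congr 1
  omega

theorem loc_eq (hl : ∀ n, 2 ≤ c.l n) {n : ℕ} (hn : 2 ≤ n) {x : ℤ → Sym Unit} {r : ℕ}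
    (h : IsLocation c n x r) : loc c n x = r := by
  have : {r | IsLocation c n x r} = {r} := by
    ext r'
    exact ⟨fun h' => isLocation_unique hl hn h' h, fun h' => by rw [h']; exact h⟩
  rw [loc, this, csInf_singleton]

end Unique

/-! ### Positions and sublocations -/

section Positions

variable (c : CoeffSeq)

/-- The location in the `n`-block of an interior position `r` of an `(n+1)`-word. -/
def locOf (n r : ℕ) : ℕ := (r + jj (c.p n) (c.q n) (sub2 c n r)) % c.q n

/-- Position `r` of an `(n+1)`-word is far from the ends of its 1-subsection. -/
def IsSafe (n r : ℕ) : Prop :=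
  4 * c.q n ≤ r % (c.l n * c.q n) ∧ r % (c.l n * c.q n) + 4 * c.q n ≤ c.l n * c.q n

theorem sub2_def (n r : ℕ) : sub2 c n r = r / (c.k n * (c.l n * c.q n)) := by
  rw [sub2, mul_assoc]

theorem sub1_def (n r : ℕ) :
    sub1 c n r = r % (c.k n * (c.l n * c.q n)) / (c.l n * c.q n) := by
  rw [sub1, mul_assoc]

theorem q_succ' (n : ℕ) : c.q (n + 1) = c.k n * (c.l n * c.q n) * c.q n := by
  rw [c.q_succ]; ring

theorem lq_pos (n : ℕ) : 0 < c.l n * c.q n := by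
  have := c.q_pos n
  have := c.l_pos n
  positivity

theorem klq_pos (n : ℕ) : 0 < c.k n * (c.l n * c.q n) := by
  have := c.k_pos n
  have := lq_pos c n
  positivity

theorem position_eq (n r : ℕ) : r = sub2 c n r * (c.k n * (c.l n * c.q n)) +
    (sub1 c n r * (c.l n * c.q n) + r % (c.l n * c.q n)) := by
  have h1 := Nat.div_add_mod' r (c.k n * (c.l n * c.q n))
  have h2 := Nat.div_add_mod' (r % (c.k n * (c.l n * c.q n))) (c.l n * c.q n)
  have h3 : r % (c.k n * (c.l n * c.q n)) % (c.l n * c.q n) = r % (c.l n * c.q n) :=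
    Nat.mod_mod_of_dvd _ (Dvd.intro_left _ rfl)
  rw [sub2_def, sub1_def]
  omega

theorem sub1_lt (n r : ℕ) : sub1 c n r < c.k n := by
  rw [sub1_def, Nat.div_lt_iff_lt_mul (lq_pos c n)]
  exact Nat.mod_lt _ (klq_pos c n)

theorem sub2_lt {n r : ℕ} (hr : r < c.q (n + 1)) : sub2 c n r < c.q n := by
  rw [sub2_def, Nat.div_lt_iff_lt_mul (klq_pos c n)]
  rw [q_succ'] at hr
  linarith

theorem locOf_lt (n r : ℕ) : locOf c n r < c.q n := Nat.mod_lt _ (c.q_pos n)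

variable {c}

theorem IsSafe.isInterior {n r : ℕ} (h : IsSafe c n r) : IsInterior c n r := by
  have hj := jj_lt (p := c.p n) (c.q_pos n) (sub2 c n r)
  have := pred_mul_add (q := c.q n) (c.l_pos n)
  have := h.1
  have := h.2
  constructor <;> simp only [leadB] <;> omega

theorem segment_block {A : Type*} {n : ℕ} {v : Fin (c.k n) → List (Sym A)}
    (hv : ∀ j, (v j).length = c.q n) {x : ℤ → Sym A} {a : ℤ}
    (hx : segment x a (c.q (n + 1)) = c.circ n v) {i j t : ℕ} (hi : i < c.q n) (hj : j < c.k n)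
    (ht : t < c.l n - 1) :
    segment x (a + (i * (c.k n * (c.l n * c.q n)) + (j * (c.l n * c.q n) +
      (c.q n - jj (c.p n) (c.q n) i + t * c.q n)) : ℕ)) (c.q n) = v ⟨j, hj⟩ := by
  rw [segment_eq_iff (hv _)]
  intro u hu
  have h := getElem?_circ_word (p := c.p n) (c.q_pos n) (c.l_pos n) hv hi hj ht hu
  obtain ⟨s, hs⟩ : ∃ s, (v ⟨j, hj⟩)[u]? = some s :=
    ⟨_, List.getElem?_eq_getElem (by rw [hv]; exact hu)⟩
  rw [hs] at h ⊢
  rw [← eq_of_segment (length_coeffCirc c n hv) hx h]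
  congr 2
  push_cast
  ring

/-- A margin of 4 q_n on both sides leaves room for a move by at most 2 q_n together with a whole
copy, so the moved point is still in the same power and sees the same argument. With d = 0 this also
identifies the block around 0. -/
theorem segment_shiftZ_of_isSafe {A : Type*} {n : ℕ} {v : Fin (c.k n) → List (Sym A)}
    (hv : ∀ j, (v j).length = c.q n) {x : ℤ → Sym A} {r : ℕ} (hr : r < c.q (n + 1))
    (hs : IsSafe c n r) (hx : segment x (-(r : ℤ)) (c.q (n + 1)) = c.circ n v) {d : ℤ} {r' : ℕ}
    (hr' : r' < c.q n) (hd : (c.q n : ℤ) ∣ r' - locOf c n r - d) (hd1 : -(2 * c.q n) ≤ d)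
    (hd2 : d ≤ 2 * c.q n) :
    segment (shiftZ d x) (-(r' : ℤ)) (c.q n) = v ⟨sub1 c n r, sub1_lt c n r⟩ := by
  have hq := c.q_pos n
  have hjq := jj_lt (p := c.p n) (c.q_pos n) (sub2 c n r)
  have h1 := pred_mul_add (q := c.q n) (c.l_pos n)
  obtain ⟨hs1, hs2⟩ := hs
  have hl : 4 ≤ c.l n := by
    by_contra h
    have : c.l n * c.q n ≤ 3 * c.q n := Nat.mul_le_mul_right _ (by omega)
    omega
  set o := r % (c.l n * c.q n) with ho
  set J := jj (c.p n) (c.q n) (sub2 c n r) with hJ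
  have hdvd : (c.q n : ℤ) ∣ o + d - r' - (c.q n - J : ℕ) := by
    have h2 : (c.q n : ℤ) ∣ (r : ℤ) + J - locOf c n r := by
      have h4 := Nat.div_add_mod' (r + J) (c.q n)
      rw [locOf, ← hJ]
      exact ⟨((r + J) / c.q n : ℕ), by push_cast; zify at h4; linarith⟩
    have h3 : (c.q n : ℤ) ∣ (r : ℤ) - o := by
      have h4 := Nat.div_add_mod' r (c.l n * c.q n)
      exact ⟨((r / (c.l n * c.q n) * c.l n : ℕ)), by push_cast; zify at h4; linarith⟩
    have h4 : (c.q n : ℤ) ∣ (c.q n : ℤ) := dvd_rfl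
    have h5 := ((h2.sub h3).sub hd).sub h4
    have e : ((c.q n - J : ℕ) : ℤ) = (c.q n : ℤ) - J := by push_cast [Nat.cast_sub hjq.le]; ring
    rw [e]
    have h6 : (o : ℤ) + d - r' - ((c.q n : ℤ) - J) =
        (r : ℤ) + J - locOf c n r - (r - o) - (r' - locOf c n r - d) - c.q n := by ring
    rw [h6]
    exact h5
  obtain ⟨t, ht⟩ := hdvd
  have e : ((c.q n - J : ℕ) : ℤ) = (c.q n : ℤ) - J := by push_cast [Nat.cast_sub hjq.le]; ring
  have h2 : ((c.l n - 2 : ℕ) : ℤ) * c.q n + 2 * c.q n = (c.l n : ℤ) * c.q n := by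
    push_cast [Nat.cast_sub (by omega : 2 ≤ c.l n)]; ring
  have hs2' : (o : ℤ) + 4 * c.q n ≤ c.l n * c.q n := by exact_mod_cast hs2
  have ht0 : 0 ≤ t := by
    have : (c.q n : ℤ) * (-1) < c.q n * t := by rw [← ht]; omega
    have := lt_of_mul_lt_mul_left this (by omega)
    omega
  have ht1 : t < (c.l n - 2 : ℕ) := by
    have : (c.q n : ℤ) * t < c.q n * (c.l n - 2 : ℕ) := by
      rw [← ht, mul_comm (c.q n : ℤ)]; omega
    exact lt_of_mul_lt_mul_left this (by omega)
  lift t to ℕ using ht0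
  have := segment_block hv hx (sub2_lt c hr) (sub1_lt c n r) (t := t) (by omega)
  rw [← this, segment_shiftZ]
  congr 1
  have h5 := position_eq c n r
  rw [← ho] at h5
  rw [← hJ]
  have h6 : (r : ℤ) = (sub2 c n r : ℤ) * (c.k n * (c.l n * c.q n)) +
    ((sub1 c n r : ℤ) * (c.l n * c.q n) + o) := by exact_mod_cast h5
  have h7 : (((sub2 c n r * (c.k n * (c.l n * c.q n)) + (sub1 c n r * (c.l n * c.q n) +
      (c.q n - J + t * c.q n)) : ℕ)) : ℤ) = (sub2 c n r : ℤ) * (c.k n * (c.l n * c.q n)) +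
      ((sub1 c n r : ℤ) * (c.l n * c.q n) + ((c.q n - J : ℕ) + t * c.q n)) := by push_cast; ring
  rw [h7]
  linarith

theorem segment_of_isSafe {A : Type*} {n : ℕ} {v : Fin (c.k n) → List (Sym A)}
    (hv : ∀ j, (v j).length = c.q n) {x : ℤ → Sym A} {r : ℕ} (hr : r < c.q (n + 1))
    (hs : IsSafe c n r) (hx : segment x (-(r : ℤ)) (c.q (n + 1)) = c.circ n v) :
    segment x (-(locOf c n r : ℤ)) (c.q n) = v ⟨sub1 c n r, sub1_lt c n r⟩ := by
  have := segment_shiftZ_of_isSafe hv hr hs hx (d := 0) (locOf_lt c n r) (by simp) (by simp)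
    (by simp)
  rwa [shiftZ_zero] at this

/-- With M = k_n l_n q_n one has p_{n+1} = p_n M + 1. Writing r = iM + e gives p_{n+1} r ≡ M (p_n e
+ i) + e modulo M q_n, and p_n e + i ≡ p_n (r + j_i) modulo q_n because q_n divides M and p_n j_i ≡
i. This is the refinement of circle arcs from one stage to the next. -/
theorem mul_mod_succ (n : ℕ) (r : ℕ) :
    (c.p (n + 1) * r) % c.q (n + 1) = c.k n * (c.l n * c.q n) * ((c.p n * locOf c n r) % c.q n) +
      r % (c.k n * (c.l n * c.q n)) := by
  set M := c.k n * (c.l n * c.q n) with hM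
  have hMpos : 0 < M := klq_pos c n
  have hr := Nat.div_add_mod' r M
  have hi : sub2 c n r = r / M := sub2_def c n r
  set i := r / M
  set e := r % M with he
  have heM : e < M := Nat.mod_lt _ hMpos
  have hp : c.p (n + 1) = c.p n * M + 1 := by rw [c.p_succ, hM]; ring
  have hX : (c.p n * locOf c n r) % c.q n = (c.p n * e + i) % c.q n := by
    have h1 : (c.p n * locOf c n r : ZMod (c.q n)) = c.p n * e + i := by
      have h2 : (locOf c n r : ZMod (c.q n)) = (r : ZMod (c.q n)) + (jj (c.p n) (c.q n) i : ℕ) := by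
        rw [locOf, hi, ZMod.natCast_mod]; push_cast; ring
      have h3 : (r : ZMod (c.q n)) = e := by
        rw [← hr, hM]; push_cast; simp
      rw [h2, h3, mul_add, mul_jj]
    exact (ZMod.natCast_eq_natCast_iff' _ _ _).1 (by exact_mod_cast h1)
  rw [hX, q_succ', ← hM]
  set X := c.p n * e + i with hXd
  have h4 : c.p (n + 1) * r = M * (X % c.q n) + e + (M * c.q n) * (X / c.q n +
      c.p n * i * (c.k n * c.l n)) := by
    have h5 := Nat.div_add_mod X (c.q n)
    have h6 : c.p (n + 1) * r = M * X + e + M * (c.p n * i * M) := by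
      rw [hp, ← hr, hXd]; ring
    have h7 : M * (c.p n * i * M) = M * c.q n * (c.p n * i * (c.k n * c.l n)) := by
      nth_rw 2 [hM]; ring
    rw [h6, h7]
    conv_lhs => rw [← h5]
    ring
  rw [h4, Nat.add_mul_mod_self_left]
  apply Nat.mod_eq_of_lt
  have h8 := Nat.mod_lt X (c.q_pos n)
  nlinarith

theorem eq_of_mul_mod_eq {n r r' : ℕ} (hr : r < c.q n) (hr' : r' < c.q n)
    (h : (c.p n * r) % c.q n = (c.p n * r') % c.q n) : r = r' := by
  have h1 : ((c.p n * r : ℕ) : ZMod (c.q n)) = (c.p n * r' : ℕ) :=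
    (ZMod.natCast_eq_natCast_iff' _ _ _).2 h
  push_cast at h1
  have h2 := (isUnit_p c n).mul_left_cancel h1
  have h3 := (ZMod.natCast_eq_natCast_iff' _ _ _).1 h2
  rwa [Nat.mod_eq_of_lt hr, Nat.mod_eq_of_lt hr'] at h3

/-- Dividing the identity of `mul_mod_succ` by M forgets the position inside the coarse arc, and
multiplication by p_n is injective modulo q_n. -/
theorem locOf_eq_of_mul_mod {n r s I : ℕ} (hs : s < c.q n)
    (hr : (c.p (n + 1) * r) % c.q (n + 1) = I % c.q (n + 1))
    (hs' : (c.p n * s) % c.q n = (I / (c.k n * (c.l n * c.q n))) % c.q n) : locOf c n r = s := by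
  apply eq_of_mul_mod_eq (locOf_lt c n r) hs
  rw [hs']
  rw [mul_mod_succ, q_succ'] at hr
  have h1 := Nat.mod_lt r (klq_pos c n)
  have h2 := Nat.mod_lt I (klq_pos c n)
  set M := c.k n * (c.l n * c.q n)
  have h4 : I % (M * c.q n) = I % M + M * (I / M % c.q n) := Nat.mod_mul
  rw [h4] at hr
  have h3 := congrArg (· / M) hr
  rwa [Nat.mul_add_div (klq_pos c n), Nat.div_eq_of_lt h1, Nat.add_mul_div_left _ _ (klq_pos c n),
    Nat.div_eq_of_lt h2, add_zero, zero_add] at h3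

/-- The arc of r immediately precedes that of r'. As r' is not at the start of its 1-subsection,
stepping back causes no carry into the coarse arc or the argument index: only the offset drops by
one. -/
theorem adjacent_of_isSafe {n r r' : ℕ} (hs : IsSafe c n r')
    (h : (c.p (n + 1) * r + 1) % c.q (n + 1) = (c.p (n + 1) * r') % c.q (n + 1)) :
    sub1 c n r = sub1 c n r' ∧ locOf c n r = locOf c n r' ∧
      r % (c.l n * c.q n) + 1 = r' % (c.l n * c.q n) := by
  have hq := c.q_pos n
  have hM := klq_pos c n
  have hL := lq_pos c n
  have k1 := mul_mod_succ (c := c) n r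
  have k2 := mul_mod_succ (c := c) n r'
  have hQ := c.q_pos (n + 1)
  rw [Nat.add_mod, ] at h
  have hlt := Nat.mod_lt (c.p (n + 1) * r) hQ
  rw [k1] at h hlt
  rw [k2] at h
  rw [sub1_def, sub1_def]
  have m1 : r % (c.k n * (c.l n * c.q n)) % (c.l n * c.q n) = r % (c.l n * c.q n) :=
    Nat.mod_mod_of_dvd _ (Dvd.intro_left _ rfl)
  have m2 : r' % (c.k n * (c.l n * c.q n)) % (c.l n * c.q n) = r' % (c.l n * c.q n) :=
    Nat.mod_mod_of_dvd _ (Dvd.intro_left _ rfl)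
  have e1 := Nat.mod_lt r hM
  have e2 := Nat.mod_lt r' hM
  set M := c.k n * (c.l n * c.q n)
  have hpos : 0 < r' % M := by
    rcases Nat.eq_zero_or_pos (r' % M) with h0 | h0
    · rw [h0, Nat.zero_mod] at m2
      have := hs.1
      omega
    · exact h0
  have h1q : 1 % c.q (n + 1) = 1 := Nat.mod_eq_of_lt (two_le_q n)
  have key : M * ((c.p n * locOf c n r) % c.q n) + (r % M + 1) =
      M * ((c.p n * locOf c n r') % c.q n) + r' % M := by
    rw [h1q] at h
    rcases Nat.lt_or_ge (M * ((c.p n * locOf c n r) % c.q n) + r % M + 1) (c.q (n + 1)) with h' | h'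
    · rw [Nat.mod_eq_of_lt h'] at h
      omega
    · have : M * ((c.p n * locOf c n r) % c.q n) + r % M + 1 = c.q (n + 1) := by omega
      rw [this, Nat.mod_self] at h
      omega
  have ha : (c.p n * locOf c n r) % c.q n = (c.p n * locOf c n r') % c.q n := by
    apply le_antisymm
    · by_contra hlt
      have := Nat.mul_le_mul_left M (Nat.succ_le_of_lt (not_le.1 hlt))
      rw [Nat.succ_eq_add_one, mul_add, mul_one] at this
      omega
    · by_contra hlt
      have := Nat.mul_le_mul_left M (Nat.succ_le_of_lt (not_le.1 hlt))
      rw [Nat.succ_eq_add_one, mul_add, mul_one] at this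
      omega
  have hrem : r % M + 1 = r' % M := by rw [ha] at key; omega
  have hs1 := hs.1
  have d1 := Nat.div_add_mod' (r % M) (c.l n * c.q n)
  have d2 := Nat.div_add_mod' (r' % M) (c.l n * c.q n)
  have l1 := Nat.mod_lt (r % M) hL
  have l2 := Nat.mod_lt (r' % M) hL
  rw [m1] at d1 l1
  rw [m2] at d2 l2
  have hdiv : r % M / (c.l n * c.q n) = r' % M / (c.l n * c.q n) := by
    apply le_antisymm
    · exact Nat.div_le_div_right (by omega)
    · rw [Nat.le_div_iff_mul_le hL]
      omega
  refine ⟨hdiv, eq_of_mul_mod_eq (locOf_lt c n _) (locOf_lt c n _) ha, ?_⟩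
  rw [hdiv] at d1
  omega

end Positions

/-! ### Pointwise limits of powers of the shift -/

section Limits

theorem continuous_shiftZ {Γ : Type*} [TopologicalSpace Γ] (d : ℤ) :
    Continuous (shiftZ d : (ℤ → Γ) → ℤ → Γ) :=
  continuous_pi fun i => continuous_apply (i + d)

theorem tendsto_pi_discrete {Γ : Type*} [TopologicalSpace Γ] [DiscreteTopology Γ]
    {f : ℕ → ℤ → Γ} {z : ℤ → Γ} :
    Tendsto f atTop (𝓝 z) ↔ ∀ u, ∀ᶠ n in atTop, f n u = z u := by
  rw [tendsto_pi_nhds]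
  refine forall_congr' fun u => ?_
  rw [nhds_discrete, tendsto_pure]

theorem limit_commute {Γ : Type*} [TopologicalSpace Γ] [DiscreteTopology Γ] [MeasurableSpace Γ]
    {ν : Measure (ℤ → Γ)} (hT : MeasurePreserving (shiftZ 1) ν ν) {a : ℕ → ℤ}
    {F : (ℤ → Γ) → ℤ → Γ}
    (h : ∀ᵐ s ∂ν, Tendsto (fun n => shiftZ (a n) s) atTop (𝓝 (F s))) :
    ∀ᵐ s ∂ν, ∀ d : ℤ, F (shiftZ d s) = shiftZ d (F s) := by
  rw [ae_all_iff]
  intro d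
  filter_upwards [h, (measurePreserving_shiftZ hT d).quasiMeasurePreserving.ae h] with s h1 h2
  refine tendsto_nhds_unique h2 ?_
  have h3 := ((continuous_shiftZ d).tendsto _).comp h1
  refine h3.congr fun n => ?_
  simp only [Function.comp, shiftZ_shiftZ, add_comm]

variable {Γ : Type*} [Countable Γ] [TopologicalSpace Γ] [DiscreteTopology Γ] [MeasurableSpace Γ]
  [BorelSpace Γ] {ν : Measure (ℤ → Γ)}

/-- Integrals of bounded continuous functions determine a finite measure, and by dominated
convergence the limit map preserves them. -/
theorem exists_measurePreserving_limit [IsProbabilityMeasure ν]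
    (hT : MeasurePreserving (shiftZ 1) ν ν) {a : ℕ → ℤ}
    (h : ∀ᵐ s ∂ν, ∃ z, Tendsto (fun n => shiftZ (a n) s) atTop (𝓝 z)) :
    ∃ F : (ℤ → Γ) → ℤ → Γ, MeasurePreserving F ν ν ∧
      ∀ᵐ s ∂ν, Tendsto (fun n => shiftZ (a n) s) atTop (𝓝 (F s)) := by
  obtain ⟨F, hF, hlim⟩ := measurable_limit_of_tendsto_metrizable_ae
    (fun n => (measurable_shiftZ (Γ := Γ) (a n)).aemeasurable) h
  refine ⟨F, ⟨hF, ?_⟩, hlim⟩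
  have : IsProbabilityMeasure (ν.map F) := Measure.isProbabilityMeasure_map hF.aemeasurable
  refine ext_of_forall_integral_eq_of_IsFiniteMeasure fun f => ?_
  rw [integral_map hF.aemeasurable f.continuous.aestronglyMeasurable]
  have h1 : Tendsto (fun n => ∫ s, f (shiftZ (a n) s) ∂ν) atTop (𝓝 (∫ s, f (F s) ∂ν)) := by
    refine tendsto_integral_of_dominated_convergence (fun _ => ‖f‖)
      (fun n => (f.continuous.comp (continuous_shiftZ (a n))).aestronglyMeasurable)
      (integrable_const _) (fun n => ae_of_all _ fun s => f.norm_coe_le_norm _) ?_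
    filter_upwards [hlim] with s hs
    exact (f.continuous.tendsto _).comp hs
  have h2 : ∀ n, ∫ s, f (shiftZ (a n) s) ∂ν = ∫ s, f s ∂ν := fun n => by
    have hm := measurePreserving_shiftZ hT (a n)
    conv_rhs => rw [← hm.map_eq]
    rw [integral_map hm.aemeasurable f.continuous.aestronglyMeasurable]
  simp only [h2] at h1
  exact tendsto_nhds_unique h1 tendsto_const_nhds

/-- Convergence in measure at the coordinate 0. Unlike a pointwise statement it survives replacing s
by translates that depend on n, which the next two results rely on. -/
theorem tendsto_measure_ne [IsProbabilityMeasure ν] {a : ℕ → ℤ} {F : (ℤ → Γ) → ℤ → Γ}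
    (hF : Measurable F) (h : ∀ᵐ s ∂ν, Tendsto (fun n => shiftZ (a n) s) atTop (𝓝 (F s))) :
    Tendsto (fun n => ν {s | F s 0 ≠ s (a n)}) atTop (𝓝 0) := by
  have hm : ∀ n, MeasurableSet {s : ℤ → Γ | F s 0 ≠ s (a n)} := fun n =>
    (measurableSet_eq_fun ((measurable_pi_apply 0).comp hF) (measurable_pi_apply (a n))).compl
  rw [← measure_empty (μ := ν)]
  refine tendsto_measure_of_ae_tendsto_indicator_of_isFiniteMeasure atTop MeasurableSet.empty hm ?_
  filter_upwards [h] with s hs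
  filter_upwards [(tendsto_pi_discrete).1 hs 0] with n hn
  simp only [shiftZ, zero_add] at hn
  simp [hn]

/-- Both G(Fs)(0) and s(0) are compared with (Fs)(-a_n): the first through T^{-a_n} → G at the point
Fs, the second through T^{a_n} → F at the point T^{-a_n}s, since F commutes with the shift. Both
errors tend to 0 in measure. -/
theorem limit_comp_limit [IsProbabilityMeasure ν] (hT : MeasurePreserving (shiftZ 1) ν ν)
    {a : ℕ → ℤ} {F G : (ℤ → Γ) → ℤ → Γ} (hF : MeasurePreserving F ν ν)
    (hG : MeasurePreserving G ν ν)
    (hFlim : ∀ᵐ s ∂ν, Tendsto (fun n => shiftZ (a n) s) atTop (𝓝 (F s)))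
    (hGlim : ∀ᵐ s ∂ν, Tendsto (fun n => shiftZ (-a n) s) atTop (𝓝 (G s))) :
    ∀ᵐ s ∂ν, G (F s) = s := by
  have hFc := limit_commute hT hFlim
  have hGc := limit_commute hT hGlim
  have meas1 : MeasurableSet {s : ℤ → Γ | G (F s) 0 ≠ s 0} :=
    (measurableSet_eq_fun ((measurable_pi_apply 0).comp (hG.measurable.comp hF.measurable))
      (measurable_pi_apply 0)).compl
  have h0 : ν {s | G (F s) 0 ≠ s 0} = 0 := by
    have hle : ∀ n, ν {s | G (F s) 0 ≠ s 0} ≤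
        ν {s | G s 0 ≠ s (-a n)} + ν {s | F s 0 ≠ s (a n)} := by
      intro n
      have m1 : MeasurableSet {s : ℤ → Γ | G s 0 ≠ s (-a n)} :=
        (measurableSet_eq_fun ((measurable_pi_apply 0).comp hG.measurable)
          (measurable_pi_apply _)).compl
      have m2 : MeasurableSet {s : ℤ → Γ | F s 0 ≠ s (a n)} :=
        (measurableSet_eq_fun ((measurable_pi_apply 0).comp hF.measurable)
          (measurable_pi_apply _)).compl
      rw [← hF.measure_preimage m1.nullMeasurableSet,
        ← (measurePreserving_shiftZ hT (-a n)).measure_preimage m2.nullMeasurableSet]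
      refine le_trans (measure_mono_ae ?_) (measure_union_le _ _)
      filter_upwards [hFc] with s hs h
      by_contra hcon
      have hcon' : G (F s) 0 = F s (-a n) ∧ F (shiftZ (-a n) s) 0 = shiftZ (-a n) s (a n) := by
        constructor
        · by_contra h'
          exact hcon (Or.inl h')
        · by_contra h'
          exact hcon (Or.inr h')
      obtain ⟨e1, e2⟩ := hcon'
      rw [hs] at e2
      simp only [shiftZ, zero_add, add_neg_cancel] at e2
      exact h (e1.trans e2)
    have hlim := (tendsto_measure_ne hG.measurable hGlim).add
      (tendsto_measure_ne hF.measurable hFlim)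
    rw [add_zero] at hlim
    exact le_antisymm (ge_of_tendsto' hlim hle) bot_le
  -- Agreement at the coordinate 0 for all translates of s gives agreement at every coordinate.
  have hall : ∀ᵐ s ∂ν, ∀ d : ℤ, G (F (shiftZ d s)) 0 = shiftZ d s 0 := by
    rw [ae_all_iff]
    intro d
    refine (measurePreserving_shiftZ hT d).quasiMeasurePreserving.ae
      (p := fun s => G (F s) 0 = s 0) ?_
    exact h0
  filter_upwards [hall, hFc, hF.quasiMeasurePreserving.ae hGc] with s h1 h2 h3
  funext d
  have := h1 d
  rw [h2, h3] at this
  simpa [shiftZ] using this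

/-- Translation by a_k + a_l turns s(-a_k) and s(-a_l) into s(a_l) and s(a_k), both of which mostly
equal (Fs)(0). So the inverse powers are Cauchy in measure, and a fast subsequence converges a.e. by
Borel–Cantelli. -/
theorem exists_subseq_limit_neg [IsProbabilityMeasure ν] (hT : MeasurePreserving (shiftZ 1) ν ν)
    {a : ℕ → ℤ} {F : (ℤ → Γ) → ℤ → Γ} (hF : Measurable F)
    (hFlim : ∀ᵐ s ∂ν, Tendsto (fun n => shiftZ (a n) s) atTop (𝓝 (F s))) :
    ∃ φ : ℕ → ℕ, StrictMono φ ∧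
      ∀ᵐ s ∂ν, ∃ z, Tendsto (fun n => shiftZ (-a (φ n)) s) atTop (𝓝 z) := by
  have hlim := tendsto_measure_ne hF hFlim
  obtain ⟨φ, hφ, hb⟩ := extraction_forall_of_eventually' fun k : ℕ =>
    (hlim.eventually (Iio_mem_nhds (show (0 : ENNReal) < (2⁻¹ : ENNReal) ^ k from
      ENNReal.pow_pos (by simp) k))).exists_forall_of_atTop
  refine ⟨φ, hφ, ?_⟩
  have hb' : ∀ k, ν {s | F s 0 ≠ s (a (φ k))} ≤ (2⁻¹ : ENNReal) ^ k := fun k => (hb k).le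
  have hsum : ∑' k : ℕ, ν {s : ℤ → Γ | s (-a (φ k)) ≠ s (-a (φ (k + 1)))} ≠ ⊤ := by
    have hle : ∀ k, ν {s : ℤ → Γ | s (-a (φ k)) ≠ s (-a (φ (k + 1)))} ≤
        2 * (2⁻¹ : ENNReal) ^ k := by
      intro k
      have m : MeasurableSet {s : ℤ → Γ | s (-a (φ k)) ≠ s (-a (φ (k + 1)))} :=
        (measurableSet_eq_fun (measurable_pi_apply (-a (φ k)))
          (measurable_pi_apply (-a (φ (k + 1))))).compl
      rw [← (measurePreserving_shiftZ hT (a (φ k) + a (φ (k + 1)))).measure_preimage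
        m.nullMeasurableSet]
      calc _ ≤ ν ({s | F s 0 ≠ s (a (φ k))} ∪ {s | F s 0 ≠ s (a (φ (k + 1)))}) := by
            refine measure_mono fun s hs => ?_
            by_contra hcon
            simp only [Set.mem_union, Set.mem_ofPred_eq, not_or, not_not] at hcon
            apply hs
            simp only [shiftZ]
            rw [show -a (φ k) + (a (φ k) + a (φ (k + 1))) = a (φ (k + 1)) by ring,
              show -a (φ (k + 1)) + (a (φ k) + a (φ (k + 1))) = a (φ k) by ring, ← hcon.1, ← hcon.2]
        _ ≤ _ := measure_union_le _ _
        _ ≤ (2⁻¹ : ENNReal) ^ k + (2⁻¹ : ENNReal) ^ k := by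
            gcongr
            · exact hb' k
            · exact (hb' (k + 1)).trans (pow_le_pow_right_of_le_one' (by simp) (Nat.le_succ k))
        _ = _ := (two_mul _).symm
    refine ne_top_of_le_ne_top ?_ (ENNReal.tsum_le_tsum hle)
    rw [ENNReal.tsum_mul_left, ENNReal.tsum_geometric]
    simp [ENNReal.mul_eq_top]
  have hae := ae_eventually_notMem hsum
  have hall : ∀ᵐ s ∂ν, ∀ d : ℤ, ∀ᶠ k in atTop,
      shiftZ d s (-a (φ k)) = shiftZ d s (-a (φ (k + 1))) := by
    rw [ae_all_iff]
    intro d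
    refine (measurePreserving_shiftZ hT d).quasiMeasurePreserving.ae
      (p := fun s => ∀ᶠ k in atTop, s (-a (φ k)) = s (-a (φ (k + 1)))) ?_
    filter_upwards [hae] with s hs
    filter_upwards [hs] with k hk
    simpa using hk
  filter_upwards [hall] with s hs
  have hex : ∀ d : ℤ, ∃ g, ∀ᶠ k in atTop, shiftZ (-a (φ k)) s d = g := by
    intro d
    obtain ⟨N, hN⟩ := eventually_atTop.1 (hs d)
    refine ⟨shiftZ (-a (φ N)) s d, eventually_atTop.2 ⟨N, fun k hk => ?_⟩⟩
    induction k, hk using Nat.le_induction with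
    | base => rfl
    | succ k hk ih =>
      rw [← ih]
      have := hN k hk
      simp only [shiftZ] at this ⊢
      rw [add_comm d, add_comm d]
      exact this.symm
  choose z hz using hex
  exact ⟨z, (tendsto_pi_discrete).2 hz⟩

/-! ### From pointwise to weak convergence -/

theorem koopman_toLp [IsProbabilityMeasure ν] (T : MPT ν)
    (h : BoundedContinuousFunction (ℤ → Γ) ℂ) :
    T.koopman (BoundedContinuousFunction.toLp (E := ℂ) 2 ν ℂ h) =ᵐ[ν] fun s => h (T.toFun s) := by
  have h1 := Lp.coeFn_compMeasurePreserving (BoundedContinuousFunction.toLp (E := ℂ) 2 ν ℂ h)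
    T.measurePreserving
  have h2 := T.measurePreserving.quasiMeasurePreserving.ae_eq_comp
    (BoundedContinuousFunction.coeFn_toLp (p := 2) (μ := ν) ℂ h)
  exact h1.trans h2

/-- Dominated convergence handles matrix coefficients of bounded continuous functions. These are
dense in L², and Koopman operators are isometries, so the approximation error is uniform in n. -/
theorem tendsto_MPT_of_ae [IsProbabilityMeasure ν] {T : ℕ → MPT ν} {S : MPT ν}
    (h : ∀ᵐ s ∂ν, Tendsto (fun n => (T n).toFun s) atTop (𝓝 (S.toFun s))) :
    Tendsto T atTop (𝓝 S) := by
  rw [nhds_induced, tendsto_comap_iff,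
    ContinuousLinearMapWOT.tendsto_iff_forall_inner_apply_tendsto]
  intro x y
  have hdense : ∀ g : BoundedContinuousFunction (ℤ → Γ) ℂ,
      Tendsto (fun n => inner ℂ y ((T n).koopman (BoundedContinuousFunction.toLp 2 ν ℂ g))) atTop
        (𝓝 (inner ℂ y (S.koopman (BoundedContinuousFunction.toLp 2 ν ℂ g)))) := by
    intro g
    simp only [L2.inner_def]
    refine tendsto_integral_of_dominated_convergence (fun s => ‖g‖ * ‖y s‖) (fun n => ?_) ?_
      (fun n => ?_) ?_
    · exact (Lp.aestronglyMeasurable y).inner (Lp.aestronglyMeasurable _)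
    · exact ((Lp.memLp y).integrable (by norm_num)).norm.const_mul _
    · filter_upwards [koopman_toLp (T n) g] with s hs
      rw [hs]
      refine (norm_inner_le_norm _ _).trans ?_
      rw [mul_comm]
      exact mul_le_mul_of_nonneg_right (g.norm_coe_le_norm _) (norm_nonneg _)
    · have hall : ∀ᵐ s ∂ν, ∀ n, (T n).koopman (BoundedContinuousFunction.toLp (E := ℂ) 2 ν ℂ g) s =
          g ((T n).toFun s) := ae_all_iff.2 fun n => koopman_toLp (T n) g
      filter_upwards [h, hall, koopman_toLp S g] with s h1 h2 h3
      simp only [h2]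
      rw [h3]
      exact Tendsto.inner tendsto_const_nhds ((g.continuous.tendsto _).comp h1)
  rw [Metric.tendsto_atTop]
  intro ε hε
  have hd := BoundedContinuousFunction.toLp_denseRange (E := ℂ) (μ := ν) ℂ
    (p := 2) (by norm_num)
  obtain ⟨g, hg⟩ := hd.exists_dist_lt x (show 0 < ε / (3 * (‖y‖ + 1)) by positivity)
  obtain ⟨N, hN⟩ := Metric.tendsto_atTop.1 (hdense g) (ε / 3) (by positivity)
  refine ⟨N, fun n hn => ?_⟩
  have hbound : ∀ R : MPT ν, dist (inner ℂ y (R.koopman x))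
      (inner ℂ y (R.koopman (BoundedContinuousFunction.toLp 2 ν ℂ g))) < ε / 3 := by
    intro R
    rw [dist_eq_norm, ← inner_sub_right, ← map_sub]
    refine (norm_inner_le_norm _ _).trans_lt ?_
    have : ‖R.koopman (x - BoundedContinuousFunction.toLp 2 ν ℂ g)‖ =
        ‖x - BoundedContinuousFunction.toLp 2 ν ℂ g‖ :=
      (Lp.compMeasurePreservingₗᵢ ℂ R.toFun R.measurePreserving).norm_map _
    rw [this, ← dist_eq_norm]
    rw [lt_div_iff₀ (by positivity)] at hg
    have : (0 : ℝ) ≤ dist x (BoundedContinuousFunction.toLp 2 ν ℂ g) := dist_nonneg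
    nlinarith [norm_nonneg y]
  have h1 := hbound (T n)
  have h2 := hbound S
  have h3 := hN n hn
  rw [dist_comm] at h2
  calc _ ≤ _ := dist_triangle4 _ _ _ _
    _ < ε / 3 + ε / 3 + ε / 3 := add_lt_add (add_lt_add h1 h3) h2
    _ = ε := by ring

theorem exists_MPT_limit [IsProbabilityMeasure ν] (hT : MeasurePreserving (shiftZ 1) ν ν)
    {a : ℕ → ℤ} (h : ∀ᵐ s ∂ν, ∃ z, Tendsto (fun n => shiftZ (a n) s) atTop (𝓝 z)) :
    ∃ S : MPT ν, (∀ᵐ s ∂ν, Tendsto (fun n => shiftZ (a n) s) atTop (𝓝 (S.toFun s))) ∧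
      Tendsto (fun n => shiftPow hT (a n)) atTop (𝓝 S) ∧
      MPT.InCentralizer (shiftPow hT 1) S ∧ S ∈ closure (Set.range (shiftPow hT)) := by
  obtain ⟨F, hF, hFlim⟩ := exists_measurePreserving_limit hT h
  obtain ⟨φ, hφ, hneg⟩ := exists_subseq_limit_neg hT hF.measurable hFlim
  obtain ⟨G, hG, hGlim⟩ := exists_measurePreserving_limit hT hneg
  have hFlim' : ∀ᵐ s ∂ν, Tendsto (fun n => shiftZ (a (φ n)) s) atTop (𝓝 (F s)) := by
    filter_upwards [hFlim] with s hs
    exact hs.comp hφ.tendsto_atTop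
  have hGF := limit_comp_limit hT hF hG hFlim' hGlim
  have hFG := limit_comp_limit hT (a := fun n => -a (φ n)) hG hF hGlim (by simpa using hFlim')
  let S : MPT ν := ⟨F, hF, G, hG, hGF, hFG⟩
  have hlim : Tendsto (fun n => shiftPow hT (a n)) atTop (𝓝 S) := tendsto_MPT_of_ae hFlim
  refine ⟨S, hFlim, hlim, ?_, mem_closure_of_tendsto hlim (Eventually.of_forall fun n =>
    Set.mem_range_self _)⟩
  filter_upwards [limit_commute hT hFlim] with s hs
  exact hs 1

end Limits

/-! ### The words of a circular construction sequence -/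

section Construction

variable {A : Type*} {c : CoeffSeq} {P : ∀ n, Set (Fin (c.k n) → List (Sym A))}

theorem map_forget_circ (n : ℕ) (v : Fin (c.k n) → List (Sym A)) :
    (c.circ n v).map forget = c.circ n fun j => (v j).map forget := by
  simp [CoeffSeq.circ, circ, List.map_flatten, List.map_ofFn, Function.comp_def, forget]

theorem map_forget_of_mem_words (hP : IsCircular c P) (n : ℕ) {w : List (Sym A)}
    (hw : w ∈ words c P n) : w.map forget = circleWord c n := by
  induction n generalizing w with
  | zero =>
    obtain ⟨a, rfl⟩ := hw
    rfl
  | succ n ih =>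
    obtain ⟨v, hv, rfl⟩ := hw
    rw [map_forget_circ, circleWord]
    congr 1
    funext j
    exact ih (hP.mem_words n v hv j)

theorem length_of_mem_words (hP : IsCircular c P) {n : ℕ} {w : List (Sym A)}
    (hw : w ∈ words c P n) : w.length = c.q n := by
  rw [← length_circleWord, ← map_forget_of_mem_words hP n hw, List.length_map]

theorem q_strictMono : StrictMono c.q := by
  refine strictMono_nat_of_lt_succ fun n => ?_
  rw [q_succ']
  have h1 := c.two_le_k n
  have h2 := c.l_pos n
  have h3 := c.q_pos n
  have h4 : 1 ≤ c.l n * c.q n := lq_pos c n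
  have h5 : 2 ≤ c.k n * (c.l n * c.q n) := by nlinarith
  nlinarith

/-- A word of stage n has length q_n, so a window longer than q_N must come from a stage at least N.
-/
theorem exists_segment_mem_words (hP : IsCircular c P) {s : ℤ → Sym A}
    (hs : s ∈ fullSet (words c P)) (N : ℕ) :
    ∃ n, N ≤ n ∧ ∃ r < c.q n, segment s (-(r : ℤ)) (c.q n) ∈ words c P n := by
  obtain ⟨-, a, b, ha, hb, h⟩ := hs
  obtain ⟨m, hm1, hm2⟩ :=
    ((ha.eventually_gt_atTop (c.q N)).and (hb.eventually_gt_atTop 0)).exists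
  obtain ⟨n, hn⟩ := h m
  have hlen := length_of_mem_words hP hn
  rw [length_segment] at hlen
  refine ⟨n, ?_, a m, by omega, hlen ▸ hn⟩
  exact (q_strictMono (c := c)).le_iff_le.1 (by omega)

theorem words_nonempty (hP : IsCircular c P) {s : ℤ → Sym A} (hs : s ∈ fullSet (words c P))
    (n : ℕ) : (words c P n).Nonempty := by
  obtain ⟨N, hN, r, -, hr⟩ := exists_segment_mem_words hP hs n
  have hne : (words c P N).Nonempty := ⟨_, hr⟩
  induction N, hN using Nat.le_induction with
  | base => exact hne
  | succ m hm ih =>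
    obtain ⟨_, v, hv, rfl⟩ := hne
    have := hP.mem_words m v hv ⟨0, c.k_pos m⟩
    by_contra hcon
    have hall : ∀ m, n ≤ m → ¬ (words c P m).Nonempty := by
      intro m hm
      induction m, hm using Nat.le_induction with
      | base => exact hcon
      | succ m hm ih =>
        rintro ⟨_, v, hv, rfl⟩
        exact ih ⟨_, hP.mem_words m v hv ⟨0, c.k_pos m⟩⟩
    exact hall m hm ⟨_, this⟩

theorem exists_letter_mem (hP : IsCircular c P) (hne : ∀ n, (words c P n).Nonempty) (n : ℕ)
    {w : List (Sym A)} (hw : w ∈ words c P n) : ∃ a, Sym.letter a ∈ w := by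
  induction n generalizing w with
  | zero =>
    obtain ⟨a, rfl⟩ := hw
    exact ⟨a, by simp⟩
  | succ n ih =>
    obtain ⟨w', hw'⟩ := hne n
    obtain ⟨a, ha⟩ := ih hw'
    exact ⟨a, (hP.occurs n w' hw' w hw).subset ha⟩

/-- If l_n = 1, all powers are empty and a word of stage n+1 consists of spacers only, whereas each
word must contain words of all earlier stages and hence a letter. -/
theorem two_le_l (hP : IsCircular c P) (hne : ∀ n, (words c P n).Nonempty) (n : ℕ) :
    2 ≤ c.l n := by
  by_contra h
  have hl : c.l n = 1 := by have := c.l_pos n; omega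
  obtain ⟨w, hw⟩ := hne (n + 1)
  obtain ⟨a, ha⟩ := exists_letter_mem hP hne (n + 1) hw
  obtain ⟨v, hv, rfl⟩ := hw
  simp [CoeffSeq.circ, circ, hl, List.mem_flatten, List.mem_ofFn] at ha

theorem circleProj_shiftZ (d : ℤ) (s : ℤ → Sym A) :
    circleProj (shiftZ d s) = shiftZ d (circleProj s) := rfl

theorem segment_circleProj (s : ℤ → Sym A) (a : ℤ) (n : ℕ) :
    segment (circleProj s) a n = (segment s a n).map forget :=
  segment_map forget s a n

end Construction

/-! ### Good positions -/

section Good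

/-- The residue of `a` modulo `M` is far from both ends of `[0, M)`. -/
def IsFar (η : ℝ) (M a : ℕ) : Prop := η * M ≤ (a % M : ℕ) ∧ ((a % M : ℕ) : ℝ) < (1 - η) * M

/-- In each of the d periods the excluded residues are about ηM at either end; the term 1/M absorbs
rounding. -/
theorem card_not_isFar {η : ℝ} (hη : 0 ≤ η) {M d : ℕ} (hM : 0 < M) (B : Finset ℕ)
    (hB : ∀ r ∈ B, r < M * d ∧ ¬ IsFar η M r) :
    (B.card : ℝ) ≤ (M * d : ℕ) * (2 * η + 1 / M) := by
  set S := Finset.range ⌈η * M⌉₊ ∪ Finset.Ico ⌈(1 - η) * M⌉₊ M with hS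
  have h1 : B.card ≤ (Finset.range d ×ˢ S).card := by
    refine Finset.card_le_card_of_injOn (fun r => (r / M, r % M)) ?_ ?_
    · intro r hr
      obtain ⟨h1, h2⟩ := hB r hr
      have h3 := Nat.mod_lt r hM
      simp only [hS, Finset.coe_product, Set.mem_prod, Finset.mem_coe, Finset.mem_range,
        Finset.mem_union, Finset.mem_Ico]
      refine ⟨by rw [Nat.div_lt_iff_lt_mul hM, mul_comm]; exact h1, ?_⟩
      by_contra h
      push Not at h
      refine h2 ⟨Nat.ceil_le.1 h.1, ?_⟩
      by_contra h4
      exact absurd (h.2 (Nat.ceil_le.2 (not_lt.1 h4))) (not_le.2 h3)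
    · intro r _ r' _ h
      simp only [Prod.mk.injEq] at h
      rw [← Nat.div_add_mod' r M, ← Nat.div_add_mod' r' M, h.1, h.2]
  have h2 : (S.card : ℝ) ≤ 2 * (η * M) + 1 := by
    have e1 : S.card ≤ ⌈η * M⌉₊ + (M - ⌈(1 - η) * M⌉₊) := by
      refine (Finset.card_union_le _ _).trans ?_
      simp
    have e2 : (⌈η * M⌉₊ : ℝ) ≤ η * M + 1 := (Nat.ceil_lt_add_one (by positivity)).le
    have e3 : ((M - ⌈(1 - η) * M⌉₊ : ℕ) : ℝ) ≤ η * M := by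
      rcases le_total ⌈(1 - η) * M⌉₊ M with h | h
      · rw [Nat.cast_sub h]
        have := Nat.le_ceil ((1 - η) * M)
        linarith
      · rw [Nat.sub_eq_zero_of_le h]
        simp only [Nat.cast_zero]
        positivity
    have e4 : (S.card : ℝ) ≤ ⌈η * M⌉₊ + ((M - ⌈(1 - η) * M⌉₊ : ℕ) : ℝ) := by exact_mod_cast e1
    linarith
  rw [Finset.card_product, Finset.card_range] at h1
  have h3 : (B.card : ℝ) ≤ d * S.card := by exact_mod_cast h1
  have hM' : (0 : ℝ) < M := by exact_mod_cast hM
  calc (B.card : ℝ) ≤ d * S.card := h3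
    _ ≤ d * (2 * (η * M) + 1) := by gcongr
    _ = _ := by push_cast; field_simp

variable (c : CoeffSeq) (ε : ℕ → ℝ)

/-- The margin used at stage `n`. -/
noncomputable def margin (n : ℕ) : ℝ := ε n + 5 / c.l n

/-- Position `r` of an `(n+1)`-word is far from the ends of its 1-subsection, of its 2-subsection
and of the word. -/
def IsGood (n r : ℕ) : Prop :=
  IsFar (margin c ε n) (c.l n * c.q n) r ∧ IsFar (margin c ε n) (c.k n * (c.l n * c.q n)) r ∧
    IsFar (margin c ε n) (c.q (n + 1)) r

variable {c ε}

theorem margin_nonneg (hε : IsMaturitySeq ε) (n : ℕ) : 0 ≤ margin c ε n := by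
  have := (hε.mem_Ico n).1
  rw [margin]
  positivity

theorem card_not_isGood (hε : IsMaturitySeq ε) (n : ℕ) (B : Finset ℕ)
    (hB : ∀ r ∈ B, r < c.q (n + 1) ∧ ¬ IsGood c ε n r) :
    (B.card : ℝ) ≤ c.q (n + 1) * (6 * margin c ε n + 3 / c.l n) := by
  classical
  have hη := margin_nonneg (c := c) hε n
  have hl := c.l_pos n
  have hq := c.q_pos n
  have hk := c.k_pos n
  -- Each of the three moduli divides q_{n+1} and is at least l_n, so one bound with rounding term
  -- 1/l_n serves for all.
  have key : ∀ M d, c.q (n + 1) = M * d → c.l n ≤ M →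
      ((B.filter fun r => ¬ IsFar (margin c ε n) M r).card : ℝ) ≤
        c.q (n + 1) * (2 * margin c ε n + 1 / c.l n) := by
    intro M d hMd hM
    have hl' : (0 : ℝ) < c.l n := by exact_mod_cast hl
    refine (card_not_isFar hη (by omega : 0 < M) (d := d) _ fun r hr => ?_).trans ?_
    · rw [Finset.mem_filter] at hr
      exact ⟨hMd ▸ (hB r hr.1).1, hr.2⟩
    · rw [← hMd]
      gcongr
  have h1 := key (c.l n * c.q n) (c.k n * c.q n) (by rw [c.q_succ]; ring)
    (Nat.le_mul_of_pos_right _ hq)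
  have h2 := key (c.k n * (c.l n * c.q n)) (c.q n) (q_succ' c n)
    ((Nat.le_mul_of_pos_right _ hq).trans (Nat.le_mul_of_pos_left _ hk))
  have h3 := key (c.q (n + 1)) 1 (by simp) (by
    rw [q_succ']
    exact ((Nat.le_mul_of_pos_right _ hq).trans (Nat.le_mul_of_pos_left _ hk)).trans
      (Nat.le_mul_of_pos_right _ hq))
  have hsub : B ⊆ (B.filter fun r => ¬ IsFar (margin c ε n) (c.l n * c.q n) r) ∪
      ((B.filter fun r => ¬ IsFar (margin c ε n) (c.k n * (c.l n * c.q n)) r) ∪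
      (B.filter fun r => ¬ IsFar (margin c ε n) (c.q (n + 1)) r)) := by
    intro r hr
    have := (hB r hr).2
    simp only [Finset.mem_union, Finset.mem_filter, hr, true_and]
    unfold IsGood at this
    tauto
  have h4 := ((Finset.card_le_card hsub).trans (Finset.card_union_le _ _)).trans
    (Nat.add_le_add_left (Finset.card_union_le _ _) _)
  have h5 : (B.card : ℝ) ≤ (B.filter fun r => ¬ IsFar (margin c ε n) (c.l n * c.q n) r).card +
      ((B.filter fun r => ¬ IsFar (margin c ε n) (c.k n * (c.l n * c.q n)) r).card +
      ((B.filter fun r => ¬ IsFar (margin c ε n) (c.q (n + 1)) r).card : ℝ)) := by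
    exact_mod_cast h4
  have h6 : (c.q (n + 1) : ℝ) * (6 * margin c ε n + 3 / c.l n) =
      3 * (c.q (n + 1) * (2 * margin c ε n + 1 / c.l n)) := by ring
  linarith

theorem summable_margin (hε : IsMaturitySeq ε) :
    Summable fun n => 6 * margin c ε n + 3 / c.l n := by
  have h := c.summable_inv_l
  have h1 : Summable fun n => 6 * (ε n + 5 * (1 / (c.l n : ℝ))) + 3 * (1 / (c.l n : ℝ)) :=
    ((hε.summable.add (h.mul_left 5)).mul_left 6).add (h.mul_left 3)
  refine h1.congr fun n => ?_
  rw [margin]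
  ring

theorem IsGood.bounds {n r : ℕ} (h : IsGood c ε n r) :
    ε n * c.l n * c.q n + 5 * c.q n ≤ (r % (c.l n * c.q n) : ℕ) ∧
      ((r % (c.l n * c.q n) : ℕ) : ℝ) + ε n * c.l n * c.q n + 5 * c.q n ≤ c.l n * c.q n := by
  obtain ⟨⟨h1, h2⟩, -, -⟩ := h
  have hl : (0 : ℝ) < c.l n := by exact_mod_cast c.l_pos n
  have e : margin c ε n * (c.l n * c.q n : ℕ) = ε n * c.l n * c.q n + 5 * c.q n := by
    rw [margin]; push_cast; field_simp
  rw [e] at h1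
  rw [sub_mul, e] at h2
  push_cast at h1 h2 ⊢
  constructor <;> linarith

/-- The summand 5/l_n of the margin amounts to 5 q_n symbols of a 1-subsection. `IsSafe` asks for
only 4 q_n; the surplus pays for the step to a neighbouring arc in `agree_below`. -/
theorem IsGood.five_le (hε : IsMaturitySeq ε) {n r : ℕ} (h : IsGood c ε n r) :
    5 * c.q n ≤ r % (c.l n * c.q n) ∧ r % (c.l n * c.q n) + 5 * c.q n ≤ c.l n * c.q n := by
  obtain ⟨h1, h2⟩ := h.bounds
  have h3 : 0 ≤ ε n * c.l n * c.q n := by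
    have := (hε.mem_Ico n).1
    positivity
  constructor
  · have : (5 * c.q n : ℝ) ≤ (r % (c.l n * c.q n) : ℕ) := by linarith
    exact_mod_cast this
  · have : ((r % (c.l n * c.q n) : ℕ) : ℝ) + 5 * c.q n ≤ c.l n * c.q n := by linarith
    exact_mod_cast this

theorem IsGood.isSafe (hε : IsMaturitySeq ε) {n r : ℕ} (h : IsGood c ε n r) : IsSafe c n r := by
  have := h.five_le hε
  constructor <;> omega

theorem margin_ge (n : ℕ) : ε n ≤ margin c ε n := by
  rw [margin]
  have : (0 : ℝ) ≤ 5 / c.l n := by positivity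
  linarith

theorem IsGood.not_mem_setE0 (hε : IsMaturitySeq ε) {n r : ℕ} (h : IsGood c ε n r)
    {s : ℤ → Sym Unit} (hs : loc c (n + 1) s = r) : s ∉ setE0 c ε n := by
  rintro ⟨-, h'⟩
  rw [hs] at h'
  obtain ⟨h1, h2⟩ := h.bounds
  have h3 := (h.isSafe hε).1
  have hq : (0 : ℝ) < c.q n := by exact_mod_cast c.q_pos n
  have hB : leadB c n r ≤ c.q n := Nat.sub_le _ _
  have hd := Nat.div_add_mod' (r % (c.l n * c.q n) - leadB c n r) (c.q n)
  have hm := Nat.mod_lt (r % (c.l n * c.q n) - leadB c n r) (c.q_pos n)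
  have hc : copyIdx c n r = (r % (c.l n * c.q n) - leadB c n r) / c.q n := rfl
  rw [← hc] at hd
  have u1 : r % (c.l n * c.q n) < (copyIdx c n r + 1) * c.q n + c.q n := by
    rw [add_mul]; omega
  have u2 : copyIdx c n r * c.q n ≤ r % (c.l n * c.q n) := by omega
  have v1 : ((r % (c.l n * c.q n) : ℕ) : ℝ) < ((copyIdx c n r : ℝ) + 1) * c.q n + c.q n := by
    exact_mod_cast u1
  have v2 : (copyIdx c n r : ℝ) * c.q n ≤ (r % (c.l n * c.q n) : ℕ) := by exact_mod_cast u2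
  rcases h' with h' | h'
  · have := mul_le_mul_of_nonneg_right h' hq.le
    linarith
  · have := mul_le_mul_of_nonneg_right h' hq.le
    rw [sub_mul, sub_mul] at this
    linarith

theorem IsGood.not_mem_setE1 {n r : ℕ} (h : IsGood c ε n r)
    {s : ℤ → Sym Unit} (hs : loc c (n + 1) s = r) : s ∉ setE1 c ε n := by
  rintro ⟨-, h'⟩
  rw [hs] at h'
  obtain ⟨-, ⟨h1, h2⟩, -⟩ := h
  have hlq := lq_pos c n
  have hlq' : (0 : ℝ) < (c.l n * c.q n : ℕ) := by exact_mod_cast hlq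
  have hd := Nat.div_add_mod' (r % (c.k n * (c.l n * c.q n))) (c.l n * c.q n)
  have hm := Nat.mod_lt (r % (c.k n * (c.l n * c.q n))) hlq
  rw [← sub1_def] at hd
  have u1 : r % (c.k n * (c.l n * c.q n)) < (sub1 c n r + 1) * (c.l n * c.q n) := by
    rw [add_mul]; omega
  have u2 : sub1 c n r * (c.l n * c.q n) ≤ r % (c.k n * (c.l n * c.q n)) := by omega
  have v1 : ((r % (c.k n * (c.l n * c.q n)) : ℕ) : ℝ) <
      ((sub1 c n r : ℝ) + 1) * (c.l n * c.q n : ℕ) := by exact_mod_cast u1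
  have v2 : (sub1 c n r : ℝ) * (c.l n * c.q n : ℕ) ≤ (r % (c.k n * (c.l n * c.q n)) : ℕ) := by
    exact_mod_cast u2
  have hmar := mul_le_mul_of_nonneg_right (margin_ge (c := c) (ε := ε) n)
    (Nat.cast_nonneg (α := ℝ) (c.k n * (c.l n * c.q n)))
  have hM : ((c.k n * (c.l n * c.q n) : ℕ) : ℝ) = c.k n * (c.l n * c.q n : ℕ) := by push_cast; ring
  rw [hM] at hmar h1 h2
  rcases h' with h' | h'
  · have := mul_le_mul_of_nonneg_right h' hlq'.le
    linarith
  · have := mul_le_mul_of_nonneg_right h' hlq'.le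
    rw [sub_mul] at this h2
    linarith

theorem IsGood.not_mem_setE2 {n r : ℕ} (hr : r < c.q (n + 1)) (h : IsGood c ε n r)
    {s : ℤ → Sym Unit} (hs : loc c (n + 1) s = r) : s ∉ setE2 c ε n := by
  rintro ⟨-, h'⟩
  rw [hs] at h'
  obtain ⟨-, -, h1, h2⟩ := h
  rw [Nat.mod_eq_of_lt hr] at h1 h2
  have hM := klq_pos c n
  have hM' : (0 : ℝ) < (c.k n * (c.l n * c.q n) : ℕ) := by exact_mod_cast hM
  have hd := Nat.div_add_mod' r (c.k n * (c.l n * c.q n))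
  have hm := Nat.mod_lt r hM
  rw [← sub2_def] at hd
  have hQ : (c.q (n + 1) : ℝ) = c.q n * (c.k n * (c.l n * c.q n) : ℕ) := by
    rw [q_succ']; push_cast; ring
  set M := c.k n * (c.l n * c.q n)
  have u1 : r < (sub2 c n r + 1) * M := by rw [add_mul]; omega
  have u2 : sub2 c n r * M ≤ r := by omega
  have v1 : (r : ℝ) < ((sub2 c n r : ℝ) + 1) * M := by exact_mod_cast u1
  have v2 : (sub2 c n r : ℝ) * M ≤ r := by exact_mod_cast u2
  have hmar := mul_le_mul_of_nonneg_right (margin_ge (c := c) (ε := ε) n)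
    (Nat.cast_nonneg (α := ℝ) (c.q (n + 1)))
  rw [hQ] at hmar h1 h2
  rcases h' with h' | h'
  · have := mul_le_mul_of_nonneg_right h' hM'.le
    linarith
  · have := mul_le_mul_of_nonneg_right h' hM'.le
    rw [sub_mul] at this h2
    linarith

/-- Not lying in the boundary of the m-block is a property of the location at stage m given by
goodness one index lower, hence maturity starts at n + 1. -/
theorem isMature_of_isGood (hε : IsMaturitySeq ε) {s : ℤ → Sym Unit} {n : ℕ}
    (h : ∀ m, n ≤ m → HasBlock c (m + 1) s ∧ loc c (m + 1) s < c.q (m + 1) ∧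
      IsGood c ε m (loc c (m + 1) s)) : IsMature c ε (n + 1) s := by
  intro m hm
  obtain ⟨m, rfl⟩ : ∃ m', m = m' + 1 := ⟨m - 1, by omega⟩
  obtain ⟨h1, h2, h3⟩ := h m (by omega)
  obtain ⟨h4, h5, h6⟩ := h (m + 1) (by omega)
  rintro (((h | h) | h) | h)
  · rcases h with h | h
    · exact h h1
    · exact h (h3.isSafe hε).isInterior
  · exact h6.not_mem_setE0 hε rfl h
  · exact h6.not_mem_setE1 rfl h
  · exact h6.not_mem_setE2 h5 rfl h

end Good

/-! ### Almost all points have good locations -/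

section Measure

variable {A : Type*} {c : CoeffSeq} {ν : Measure (ℤ → Sym A)} {ε : ℕ → ℝ}

theorem measurableSet_isLocation (c : CoeffSeq) (n r : ℕ) :
    MeasurableSet {s : ℤ → Sym A | IsLocation c n (circleProj s) r} := by
  have : {s : ℤ → Sym A | IsLocation c n (circleProj s) r} = {_s | r < c.q n} ∩
      ⋂ i < c.q n, (fun s : ℤ → Sym A => s (-(r : ℤ) + i)) ⁻¹'
        {y | (circleWord c n)[i]? = some (forget y)} := by
    ext s
    simp only [IsLocation, segment_eq_iff (length_circleWord c n), circleProj, Set.mem_inter_iff,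
      Set.mem_iInter, Set.mem_preimage, Set.mem_ofPred_eq]
  rw [this]
  refine (MeasurableSet.const _).inter (MeasurableSet.iInter fun i => MeasurableSet.iInter fun _ =>
    measurable_pi_apply _ trivial)

theorem measure_isLocation_eq
    (hT : MeasurePreserving (shiftZ 1) ν ν) {n r : ℕ}
    (hr : r < c.q n) : ν {s | IsLocation c n (circleProj s) r} =
      ν {s | IsLocation c n (circleProj s) 0} := by
  rw [← (measurePreserving_shiftZ hT (-(r : ℤ))).measure_preimage
    (measurableSet_isLocation c n 0).nullMeasurableSet]
  congr 1
  ext s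
  simp only [IsLocation, Set.mem_preimage, Set.mem_ofPred_eq, circleProj_shiftZ, segment_shiftZ, hr,
    c.q_pos n, true_and]
  simp

/-- The q_n sets on which the location is a given r are translates of one another and, by uniqueness
of blocks, disjoint; so each has measure at most 1/q_n. -/
theorem measure_location_le [IsProbabilityMeasure ν]
    (hT : MeasurePreserving (shiftZ 1) ν ν)
    (hl : ∀ n, 2 ≤ c.l n) {n : ℕ} (hn : 2 ≤ n) (B : Finset ℕ) (hB : ∀ r ∈ B, r < c.q n) :
    ν {s | ∃ r ∈ B, IsLocation c n (circleProj s) r} ≤ B.card / c.q n := by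
  set m := ν {s | IsLocation c n (circleProj s) 0} with hm
  have h1 : (c.q n : ENNReal) * m ≤ 1 := by
    have : ν (⋃ r ∈ Finset.range (c.q n), {s | IsLocation c n (circleProj s) r}) =
        ∑ r ∈ Finset.range (c.q n), ν {s | IsLocation c n (circleProj s) r} := by
      refine measure_biUnion_finset ?_ fun r _ => measurableSet_isLocation c n r
      intro r _ r' _ hne
      refine Set.disjoint_left.2 fun s h h' => hne (isLocation_unique hl hn h h')
    rw [Finset.sum_congr rfl fun r hr => measure_isLocation_eq hT (Finset.mem_range.1 hr),
      Finset.sum_const, Finset.card_range, nsmul_eq_mul] at this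
    rw [← this]
    exact prob_le_one
  have hq : (c.q n : ENNReal) ≠ 0 := by exact_mod_cast (c.q_pos n).ne'
  have h2 : m ≤ (c.q n : ENNReal)⁻¹ := by
    rw [ENNReal.le_inv_iff_mul_le, mul_comm]
    exact h1
  calc ν {s | ∃ r ∈ B, IsLocation c n (circleProj s) r} ≤
      ν (⋃ r ∈ B, {s | IsLocation c n (circleProj s) r}) := by
        refine measure_mono fun s hs => ?_
        simpa using hs
    _ ≤ ∑ r ∈ B, ν {s | IsLocation c n (circleProj s) r} := measure_biUnion_finset_le _ _
    _ = B.card * m := by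
        rw [Finset.sum_congr rfl fun r hr => measure_isLocation_eq hT (hB r hr), Finset.sum_const,
          nsmul_eq_mul]
    _ ≤ _ := by rw [div_eq_mul_inv]; gcongr

/-- Adding d n modulo q_{n+1} permutes the locations, so the proportion of bad ones is the same for
any d. It is summable, and Borel–Cantelli applies. -/
theorem ae_eventually_isGood [IsProbabilityMeasure ν]
    (hT : MeasurePreserving (shiftZ 1) ν ν)
    (hl : ∀ n, 2 ≤ c.l n) (hε : IsMaturitySeq ε) (d : ℕ → ℕ) :
    ∀ᵐ s ∂ν, ∀ᶠ n in atTop, ∀ r, IsLocation c (n + 1) (circleProj s) r →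
      IsGood c ε n ((r + d n) % c.q (n + 1)) := by
  classical
  let B : ℕ → Finset ℕ := fun n =>
    (Finset.range (c.q (n + 1))).filter fun r => ¬ IsGood c ε n ((r + d n) % c.q (n + 1))
  have hcard : ∀ n, ((B n).card : ℝ) ≤ c.q (n + 1) * (6 * margin c ε n + 3 / c.l n) := by
    intro n
    have hinj : Set.InjOn (fun r => (r + d n) % c.q (n + 1)) (B n) := by
      intro r hr r' hr' h
      simp only [B, Finset.coe_filter, Finset.mem_range, Set.mem_ofPred_eq] at hr hr'
      have h' : r + d n ≡ r' + d n [MOD c.q (n + 1)] := h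
      exact (Nat.ModEq.add_right_cancel' _ h').eq_of_lt_of_lt hr.1 hr'.1
    rw [← Finset.card_image_of_injOn hinj]
    refine card_not_isGood hε n _ fun r hr => ?_
    obtain ⟨r', hr', rfl⟩ := Finset.mem_image.1 hr
    exact ⟨Nat.mod_lt _ (c.q_pos _), (Finset.mem_filter.1 hr').2⟩
  have hle : ∀ n, ν {s | ∃ r ∈ B (n + 1), IsLocation c (n + 2) (circleProj s) r} ≤
      ENNReal.ofReal (6 * margin c ε (n + 1) + 3 / c.l (n + 1)) := by
    intro n
    refine (measure_location_le hT hl (by omega) _ fun r hr =>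
      Finset.mem_range.1 (Finset.mem_filter.1 hr).1).trans ?_
    have hq : (0 : ℝ) < c.q (n + 2) := by exact_mod_cast c.q_pos _
    rw [← ENNReal.ofReal_natCast, ← ENNReal.ofReal_natCast, ← ENNReal.ofReal_div_of_pos hq]
    refine ENNReal.ofReal_le_ofReal ?_
    rw [div_le_iff₀ hq, mul_comm]
    exact hcard (n + 1)
  have hsum : ∑' n, ν {s | ∃ r ∈ B (n + 1), IsLocation c (n + 2) (circleProj s) r} ≠ ⊤ := by
    refine ne_top_of_le_ne_top ?_ (ENNReal.tsum_le_tsum hle)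
    exact ((summable_nat_add_iff 1).2 (summable_margin (c := c) hε)).tsum_ofReal_ne_top
  filter_upwards [ae_eventually_notMem hsum] with s hs
  obtain ⟨N, hN⟩ := eventually_atTop.1 hs
  refine eventually_atTop.2 ⟨N + 1, fun n hn r hr => ?_⟩
  obtain ⟨n, rfl⟩ : ∃ m, n = m + 1 := ⟨n - 1, by omega⟩
  by_contra hg
  exact hN n (by omega) ⟨r, Finset.mem_filter.2 ⟨Finset.mem_range.2 hr.1, hg⟩, hr⟩

end Measure

/-! ### Sequences of nested blocks -/

section Nested

theorem segment_infix {Γ : Type*} (x : ℤ → Γ) {a a' : ℤ} {n n' : ℕ} (h1 : a' ≤ a)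
    (h2 : a + n ≤ a' + n') : segment x a n <:+: segment x a' n' := by
  have : segment x a' n' = segment x a' (a - a').toNat ++ segment x a n ++
      segment x (a + n) (a' + n' - (a + n)).toNat := by
    apply List.ext_getElem?
    intro i
    rw [List.getElem?_append, List.getElem?_append]
    simp only [List.length_append, length_segment]
    simp only [segment, List.getElem?_ofFn]
    split_ifs <;> first | omega | rfl | (congr 2; omega)
  rw [this]
  exact ⟨_, _, rfl⟩

variable {c : CoeffSeq}

theorem IsSafe.lt_and_lt {n r : ℕ} (hr : r < c.q (n + 1)) (h : IsSafe c n r) :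
    n ≤ r ∧ r + n ≤ c.q (n + 1) := by
  have h0 : n ≤ c.q n := (q_strictMono (c := c)).le_apply
  obtain ⟨h1, h2⟩ := h
  have h3 : r % (c.l n * c.q n) ≤ r := Nat.mod_le _ _
  have h4 := Nat.div_add_mod' r (c.l n * c.q n)
  have h5 : c.q (n + 1) = (c.k n * c.q n) * (c.l n * c.q n) := by rw [c.q_succ]; ring
  have h6 : r / (c.l n * c.q n) < c.k n * c.q n := by
    rw [Nat.div_lt_iff_lt_mul (lq_pos c n), ← h5]
    exact hr
  have h7 : (r / (c.l n * c.q n) + 1) * (c.l n * c.q n) ≤ c.q (n + 1) := by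
    rw [h5]
    exact Nat.mul_le_mul_right _ h6
  rw [add_mul] at h7
  constructor <;> omega

/-- A safe location at stage n+1 has distance at least 4 q_n ≥ n from both ends of its word, so the
principal blocks exhaust ℤ. -/
theorem exists_window {n₀ : ℕ} {ρ : ℕ → ℕ} (hρ : ∀ n, n₀ ≤ n → ρ n < c.q n)
    (hs : ∀ n, n₀ ≤ n → IsSafe c n (ρ (n + 1))) (K : ℕ) :
    ∃ m, n₀ ≤ m ∧ ∀ n, m ≤ n → K ≤ ρ n ∧ ρ n + K ≤ c.q n := by
  refine ⟨n₀ + K + 1, by omega, fun n hn => ?_⟩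
  obtain ⟨n, rfl⟩ : ∃ m, n = m + 1 := ⟨n - 1, by omega⟩
  have := (hs n (by omega)).lt_and_lt (hρ (n + 1) (by omega))
  omega

theorem mem_circleFullSet {n₀ : ℕ} {ρ : ℕ → ℕ} {y : ℤ → Sym Unit}
    (hy : ∀ n, n₀ ≤ n → IsLocation c n y (ρ n)) (hs : ∀ n, n₀ ≤ n → IsSafe c n (ρ (n + 1))) :
    y ∈ circleFullSet c := by
  have hw := exists_window (fun n hn => (hy n hn).1) hs
  refine ⟨fun a n => ?_, fun m => ρ (n₀ + m), fun m => c.q (n₀ + m) - ρ (n₀ + m), ?_, ?_,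
    fun m => ⟨n₀ + m, ?_⟩⟩
  · obtain ⟨m, hm, h⟩ := hw (a.natAbs + n)
    refine ⟨m, circleWord c m, rfl, ?_⟩
    rw [← (hy m hm).2]
    have := h m le_rfl
    exact segment_infix _ (by omega) (by omega)
  · refine tendsto_atTop.2 fun K => ?_
    obtain ⟨m, hm, h⟩ := hw K
    filter_upwards [eventually_ge_atTop m] with n hn
    exact (h (n₀ + n) (by omega)).1
  · refine tendsto_atTop.2 fun K => ?_
    obtain ⟨m, hm, h⟩ := hw K
    filter_upwards [eventually_ge_atTop m] with n hn
    have := (h (n₀ + n) (by omega)).2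
    omega
  · have h := hy (n₀ + m) (by omega)
    have h1 := h.1
    rw [show ρ (n₀ + m) + (c.q (n₀ + m) - ρ (n₀ + m)) = c.q (n₀ + m) by omega]
    exact h.2

theorem eq_of_isLocation {n₀ : ℕ} {ρ : ℕ → ℕ} {y y' : ℤ → Sym Unit}
    (hy : ∀ n, n₀ ≤ n → IsLocation c n y (ρ n)) (hy' : ∀ n, n₀ ≤ n → IsLocation c n y' (ρ n))
    (hs : ∀ n, n₀ ≤ n → IsSafe c n (ρ (n + 1))) : y = y' := by
  funext u
  obtain ⟨m, hm, h⟩ := exists_window (fun n hn => (hy n hn).1) hs (u.natAbs + 1)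
  have h1 := h m le_rfl
  have e : u = -(ρ m : ℤ) + ((u + ρ m).toNat : ℕ) := by omega
  have e1 := (segment_eq_iff (length_circleWord c m)).1 (hy m hm).2 (u + ρ m).toNat (by omega)
  have e2 := (segment_eq_iff (length_circleWord c m)).1 (hy' m hm).2 (u + ρ m).toNat (by omega)
  rw [← e] at e1 e2
  rw [e1] at e2
  exact Option.some.inj e2

/-- Along displacements that carry the locations `r n` to locations `r'' n` agreeing one level below
with the locations `r' n`, the translates of `x` converge, and the limit has the same blocks
as `x`, at the locations `r' n`. -/
theorem exists_tendsto_of_nested {A : Type*} {x : ℤ → Sym A} {n₀ : ℕ}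
    {V : ℕ → List (Sym A)} {v : ∀ n, Fin (c.k n) → List (Sym A)} {r r' r'' d : ℕ → ℕ}
    (hv : ∀ n, n₀ ≤ n → ∀ j, (v n j).length = c.q n)
    (hV : ∀ n, n₀ ≤ n → V (n + 1) = c.circ n (v n))
    (hx : ∀ n, n₀ ≤ n → segment x (-(r n : ℤ)) (c.q n) = V n)
    (hr : ∀ n, n₀ ≤ n → r n < c.q n) (hr' : ∀ n, n₀ ≤ n → r' n < c.q n)
    (hs : ∀ n, n₀ ≤ n → IsSafe c n (r (n + 1))) (hs' : ∀ n, n₀ ≤ n → IsSafe c n (r' (n + 1)))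
    (hs'' : ∀ n, n₀ ≤ n → IsSafe c n (r'' (n + 1)))
    (hl : ∀ n, n₀ ≤ n → locOf c n (r (n + 1)) = r n)
    (hl' : ∀ n, n₀ ≤ n → locOf c n (r' (n + 1)) = r' n)
    (hl'' : ∀ n, n₀ ≤ n → locOf c n (r'' (n + 1)) = r' n)
    (hj : ∀ n, n₀ ≤ n → sub1 c n (r'' (n + 1)) = sub1 c n (r' (n + 1)))
    (hm : ∀ n, n₀ ≤ n → v n ⟨sub1 c n (r' (n + 1)), sub1_lt c _ _⟩ = V n)
    (hd : ∀ n, n₀ ≤ n → d n < c.q n) (hrd : ∀ n, n₀ ≤ n → r'' n = (r n + d n) % c.q n) :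
    ∃ z, Tendsto (fun n => shiftZ (d n : ℤ) x) atTop (𝓝 z) ∧
      ∀ n, n₀ ≤ n → segment z (-(r' n : ℤ)) (c.q n) = V n := by
  have hr'' : ∀ n, n₀ ≤ n → r'' n < c.q n := fun n hn => by
    rw [hrd n hn]; exact Nat.mod_lt _ (c.q_pos n)
  have hVlen : ∀ n, n₀ ≤ n → (V n).length = c.q n := fun n hn => by
    rw [← hx n hn, length_segment]
  -- Safety at stage n+2 keeps the translate in the power of V (n+1); inside that copy the location
  -- r'' leads to the argument of r', which is V n by the matching hypothesis `hm`.
  have htop : ∀ n, n₀ ≤ n → segment (shiftZ (d (n + 1) : ℤ) x) (-(r' n : ℤ)) (c.q n) = V n := by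
    intro n hn
    have hn1 : n₀ ≤ n + 1 := by omega
    have h1 : segment (shiftZ (d (n + 1) : ℤ) x) (-(r'' (n + 1) : ℤ)) (c.q (n + 1)) =
        V (n + 1) := by
      have e := segment_of_isSafe (hv _ hn1) (hr (n + 2) (by omega)) (hs _ hn1)
        ((hx (n + 2) (by omega)).trans (hV _ hn1))
      rw [hl _ hn1, hx _ hn1] at e
      rw [e]
      refine segment_shiftZ_of_isSafe (hv _ hn1) (hr (n + 2) (by omega)) (hs _ hn1)
        ((hx (n + 2) (by omega)).trans (hV _ hn1)) (hr'' _ hn1) ?_ (by omega)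
        (by have := hd _ hn1; omega)
      rw [hl _ hn1, hrd _ hn1]
      have h2 := Nat.div_add_mod' (r (n + 1) + d (n + 1)) (c.q (n + 1))
      refine ⟨-((r (n + 1) + d (n + 1)) / c.q (n + 1) : ℕ), ?_⟩
      zify at h2 ⊢
      linarith
    have h2 := segment_of_isSafe (hv n hn) (hr'' _ hn1) (hs'' n hn) (h1.trans (hV n hn))
    rw [hl'' n hn] at h2
    rw [h2, ← hm n hn]
    congr 1
    exact Fin.ext (hj n hn)
  -- Since the locations r' are nested, what a sequence shows at stage n+1 determines its block at
  -- stage n; so each later translate also shows V n.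
  have hdown : ∀ n, n₀ ≤ n → ∀ y : ℤ → Sym A,
      segment y (-(r' (n + 1) : ℤ)) (c.q (n + 1)) = V (n + 1) →
      segment y (-(r' n : ℤ)) (c.q n) = V n := by
    intro n hn y hy
    have h2 := segment_of_isSafe (hv n hn) (hr' _ (by omega)) (hs' n hn) (hy.trans (hV n hn))
    rw [hl' n hn] at h2
    rw [h2, hm n hn]
  have hall : ∀ n, n₀ ≤ n → ∀ n', n ≤ n' → ∀ y : ℤ → Sym A,
      segment y (-(r' n' : ℤ)) (c.q n') = V n' → segment y (-(r' n : ℤ)) (c.q n) = V n := by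
    intro n hn n' hn'
    induction n', hn' using Nat.le_induction with
    | base => exact fun y hy => hy
    | succ m hm ih => exact fun y hy => ih y (hdown m (by omega) y hy)
  have hcoord : ∀ n, n₀ ≤ n → ∀ n', n ≤ n' → segment (shiftZ (d (n' + 1) : ℤ) x) (-(r' n : ℤ))
      (c.q n) = V n := fun n hn n' hn' => hall n hn n' hn' _ (htop n' (by omega))
  have hconst : ∀ u : ℤ, ∃ g, ∀ᶠ n in atTop, shiftZ (d n : ℤ) x u = g := by
    intro u
    obtain ⟨m, hm, h⟩ := exists_window hr' hs' (u.natAbs + 1)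
    have h1 := h m le_rfl
    refine ⟨shiftZ (d (m + 1) : ℤ) x u, eventually_atTop.2 ⟨m + 1, fun n hn => ?_⟩⟩
    obtain ⟨n, rfl⟩ : ∃ k, n = k + 1 := ⟨n - 1, by omega⟩
    have e : u = -(r' m : ℤ) + ((u + r' m).toNat : ℕ) := by omega
    have e1 := (segment_eq_iff (hVlen m hm)).1 (hcoord m hm n (by omega)) (u + r' m).toNat
      (by omega)
    have e2 := (segment_eq_iff (hVlen m hm)).1 (hcoord m hm m le_rfl) (u + r' m).toNat
      (by omega)
    rw [← e] at e1 e2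
    rw [e1] at e2
    exact Option.some.inj e2
  choose z hz using hconst
  refine ⟨z, tendsto_pi_discrete.2 hz, fun n hn => ?_⟩
  have hfin : ∀ᶠ m in atTop, ∀ i ∈ Finset.range (c.q n),
      shiftZ (d m : ℤ) x (-(r' n : ℤ) + i) = z (-(r' n : ℤ) + i) :=
    (Filter.eventually_all_finset _).2 fun i _ => hz _
  obtain ⟨N, hN⟩ := eventually_atTop.1 hfin
  rw [← hcoord n hn (n + N) (by omega)]
  unfold segment
  congr 1
  funext i
  exact (hN (n + N + 1) (by omega) i (Finset.mem_range.2 i.2)).symm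

/-- Moving to the left inside a 1-subsection. -/
theorem sub1_sub {n r e : ℕ} (hs : IsSafe c n r) (he : e ≤ c.q n) :
    sub1 c n (r - e) = sub1 c n r ∧ IsInterior c n (r - e) := by
  have h1 := position_eq c n r
  have hlq := lq_pos c n
  have ho := Nat.mod_lt r hlq
  have hs1 := hs.1
  have hs2 := hs.2
  have hj := sub1_lt c n r
  have hpos : r - e = sub2 c n r * (c.k n * (c.l n * c.q n)) +
      (sub1 c n r * (c.l n * c.q n) + (r % (c.l n * c.q n) - e)) := by omega
  have ho' : r % (c.l n * c.q n) - e < c.l n * c.q n := by omega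
  have hlt : sub1 c n r * (c.l n * c.q n) + (r % (c.l n * c.q n) - e) <
      c.k n * (c.l n * c.q n) := by
    calc _ < (sub1 c n r + 1) * (c.l n * c.q n) := by rw [add_mul]; omega
      _ ≤ _ := Nat.mul_le_mul_right _ hj
  have hmod : (r - e) % (c.l n * c.q n) = r % (c.l n * c.q n) - e := by
    rw [hpos, show sub2 c n r * (c.k n * (c.l n * c.q n)) +
      (sub1 c n r * (c.l n * c.q n) + (r % (c.l n * c.q n) - e)) =
      (r % (c.l n * c.q n) - e) + (c.l n * c.q n) * (sub2 c n r * c.k n + sub1 c n r) by ring,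
      Nat.add_mul_mod_self_left, Nat.mod_eq_of_lt ho']
  constructor
  · rw [sub1_def c n (r - e), hpos, Nat.mul_add_mod', Nat.mod_eq_of_lt hlt, mul_comm (sub1 c n r),
      Nat.mul_add_div hlq, Nat.div_eq_of_lt ho', add_zero]
  · have := pred_mul_add (q := c.q n) (c.l_pos n)
    have hB : leadB c n (r - e) ≤ c.q n := Nat.sub_le _ _
    constructor <;> rw [hmod] <;> omega

end Nested

/-! ### Circle coordinates -/

section Coordinates

variable {c : CoeffSeq}

/-- The intervals from i_n/q_n to (i_n + 1)/q_n are nested, and a common point is the supremum of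
the left endpoints. By the second hypothesis right endpoints decrease strictly, so x never equals
one and its floor is exact. -/
theorem exists_floor_eq {n₀ : ℕ} {i : ℕ → ℕ}
    (h : ∀ n, n₀ ≤ n → i (n + 1) / (c.k n * (c.l n * c.q n)) = i n)
    (h' : ∀ n, n₀ ≤ n → i (n + 1) % (c.k n * (c.l n * c.q n)) + 1 < c.k n * (c.l n * c.q n)) :
    ∃ x : ℝ, 0 ≤ x ∧ ∀ n, n₀ ≤ n → ⌊x * c.q n⌋₊ = i n := by
  have hq : ∀ n, (0 : ℝ) < c.q n := fun n => by exact_mod_cast c.q_pos n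
  have hM : ∀ n, (0 : ℝ) < (c.k n * (c.l n * c.q n) : ℕ) := fun n => by
    exact_mod_cast klq_pos c n
  have hqs : ∀ n, (c.q (n + 1) : ℝ) = (c.k n * (c.l n * c.q n) : ℕ) * c.q n := fun n => by
    rw [q_succ']; push_cast; ring
  have hi : ∀ n, n₀ ≤ n → i n * (c.k n * (c.l n * c.q n)) +
      i (n + 1) % (c.k n * (c.l n * c.q n)) = i (n + 1) := fun n hn => by
    rw [← h n hn]; exact Nat.div_add_mod' _ _
  have hlow : ∀ n, n₀ ≤ n → (i n : ℝ) / c.q n ≤ i (n + 1) / c.q (n + 1) := by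
    intro n hn
    have e : ((i n : ℝ)) * (c.k n * (c.l n * c.q n) : ℕ) ≤ i (n + 1) := by
      have := hi n hn
      exact_mod_cast (by omega : i n * (c.k n * (c.l n * c.q n)) ≤ i (n + 1))
    rw [hqs, div_le_div_iff₀ (hq n) (mul_pos (hM n) (hq n)), ← mul_assoc]
    exact mul_le_mul_of_nonneg_right e (hq n).le
  have hup : ∀ n, n₀ ≤ n → ((i (n + 1) : ℝ) + 1) / c.q (n + 1) < ((i n : ℝ) + 1) / c.q n := by
    intro n hn
    have e : ((i (n + 1) : ℝ)) + 1 < (i n + 1) * (c.k n * (c.l n * c.q n) : ℕ) := by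
      have h1 := hi n hn
      have h2 := h' n hn
      have : i (n + 1) + 1 < (i n + 1) * (c.k n * (c.l n * c.q n)) := by rw [add_mul]; omega
      exact_mod_cast this
    rw [hqs, div_lt_div_iff₀ (mul_pos (hM n) (hq n)) (hq n), ← mul_assoc]
    exact mul_lt_mul_of_pos_right e (hq n)
  let f : ℕ → ℝ := fun m => (i (n₀ + m) : ℝ) / c.q (n₀ + m)
  let g : ℕ → ℝ := fun m => ((i (n₀ + m) : ℝ) + 1) / c.q (n₀ + m)
  have hf : Monotone f := monotone_nat_of_le_succ fun m => hlow (n₀ + m) (by omega)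
  have hg : Antitone g := antitone_nat_of_succ_le fun m => (hup (n₀ + m) (by omega)).le
  have hfg : f ≤ g := fun m => by
    simp only [f, g]
    gcongr
    linarith
  have hx := hf.ciSup_mem_iInter_Icc_of_antitone hg hfg
  rw [Set.mem_iInter] at hx
  set x := ⨆ n, f n
  have hx0 : 0 ≤ x := le_trans (by positivity) (hx 0).1
  refine ⟨x, hx0, fun n hn => ?_⟩
  obtain ⟨m, rfl⟩ := Nat.exists_eq_add_of_le hn
  rw [Nat.floor_eq_iff (by positivity)]
  constructor
  · exact (div_le_iff₀ (hq _)).1 (hx m).1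
  · exact (lt_div_iff₀ (hq _)).1 ((hx (m + 1)).2.trans_lt (hup (n₀ + m) (by omega)))

theorem floor_div (n : ℕ) (z : ℝ) :
    ⌊z * c.q (n + 1)⌋₊ / (c.k n * (c.l n * c.q n)) = ⌊z * c.q n⌋₊ := by
  rw [← Nat.floor_div_natCast]
  congr 1
  have : ((c.k n * (c.l n * c.q n) : ℕ) : ℝ) ≠ 0 := by exact_mod_cast (klq_pos c n).ne'
  rw [q_succ', div_eq_iff this]
  push_cast
  ring

/-- Modulo 1 the value of `rho` at stage n is ⌊z q_n⌋/q_n, which tends to z. -/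
theorem isCircleCoord_of_floor (hl : ∀ n, 2 ≤ c.l n) {n₀ : ℕ} (hn₀ : 2 ≤ n₀) {ρ : ℕ → ℕ}
    {y : ℤ → Sym Unit} (hy : ∀ n, n₀ ≤ n → IsLocation c n y (ρ n)) {z : ℝ} (hz : 0 ≤ z)
    (h : ∀ n, n₀ ≤ n → (c.p n * ρ n) % c.q n = ⌊z * c.q n⌋₊ % c.q n) :
    IsCircleCoord c y (z : UnitAddCircle) := by
  have hq : Tendsto (fun n => (c.q n : ℝ)) atTop atTop :=
    tendsto_natCast_atTop_atTop.comp (q_strictMono (c := c)).tendsto_atTop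
  have h1 : Tendsto (fun n => (⌊z * c.q n⌋₊ : ℝ) / c.q n) atTop (𝓝 z) :=
    (tendsto_nat_floor_mul_div_atTop hz).comp hq
  have h2 : Tendsto (fun n => (((⌊z * c.q n⌋₊ : ℝ) / c.q n : ℝ) : UnitAddCircle)) atTop
      (𝓝 (z : UnitAddCircle)) := ((AddCircle.continuous_mk' (1 : ℝ)).tendsto z).comp h1
  refine h2.congr' ?_
  filter_upwards [eventually_ge_atTop n₀] with n hn
  rw [rho, loc_eq hl (hn₀.trans hn) (hy n hn)]
  have hq0 : (c.q n : ℝ) ≠ 0 := by exact_mod_cast (c.q_pos n).ne'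
  have e1 := Nat.div_add_mod' (c.p n * ρ n) (c.q n)
  have e2 := Nat.div_add_mod' ⌊z * c.q n⌋₊ (c.q n)
  rw [h n hn] at e1
  set a := c.p n * ρ n / c.q n
  set b := ⌊z * c.q n⌋₊ / c.q n
  set m := ⌊z * c.q n⌋₊ % c.q n
  have f1 : (c.p n : ℝ) * ρ n = a * c.q n + m := by exact_mod_cast e1.symm
  have f2 : (⌊z * c.q n⌋₊ : ℝ) = b * c.q n + m := by exact_mod_cast e2.symm
  rw [f1, f2, add_div, add_div, mul_div_cancel_right₀ _ hq0, mul_div_cancel_right₀ _ hq0]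
  have hk : ∀ k : ℕ, ((k : ℝ) : UnitAddCircle) = 0 := fun k => by
    rw [AddCircle.coe_eq_zero_iff]
    exact ⟨k, by simp⟩
  rw [AddCircle.coe_add, AddCircle.coe_add, hk, hk]

end Coordinates

/-! ### Rotating the locations of a point -/

section Tracks

variable (c : CoeffSeq) (ε : ℕ → ℝ)

/-- The displacement at stage `n` for the rotation by `b`. -/
noncomputable def rotationShift (b : ℝ) (n : ℕ) : ℕ := jj (c.p n) (c.q n) ⌊b * c.q n⌋₊

/-- From stage `n₀` on, `r` is a sequence of nested good locations. -/
structure IsTrack (n₀ : ℕ) (r : ℕ → ℕ) : Prop where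
  lt : ∀ n, n₀ ≤ n → r n < c.q n
  good : ∀ n, n₀ ≤ n → IsGood c ε n (r (n + 1))
  loc : ∀ n, n₀ ≤ n → locOf c n (r (n + 1)) = r n

variable {c ε}

theorem IsTrack.isSafe (hε : IsMaturitySeq ε) {n₀ : ℕ} {r : ℕ → ℕ} (h : IsTrack c ε n₀ r) :
    ∀ n, n₀ ≤ n → IsSafe c n (r (n + 1)) := fun n hn => (h.good n hn).isSafe hε

theorem IsTrack.mono {n₀ n₁ : ℕ} {r : ℕ → ℕ} (h : IsTrack c ε n₀ r) (hn : n₀ ≤ n₁) :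
    IsTrack c ε n₁ r :=
  ⟨fun n h' => h.lt n (hn.trans h'), fun n h' => h.good n (hn.trans h'),
    fun n h' => h.loc n (hn.trans h')⟩

/-- Supplies the strictness needed in `exists_floor_eq`: a good location is never in the last fine
arc of its coarse arc. -/
theorem IsGood.mod_add_one_lt (hε : IsMaturitySeq ε) {n r : ℕ} (h : IsGood c ε n r) :
    r % (c.k n * (c.l n * c.q n)) + 1 < c.k n * (c.l n * c.q n) := by
  have h1 := h.2.1.2
  have hl : (0 : ℝ) < c.l n := by exact_mod_cast c.l_pos n
  have hk : (1 : ℝ) ≤ c.k n := by exact_mod_cast c.k_pos n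
  have hq : (1 : ℝ) ≤ c.q n := by exact_mod_cast c.q_pos n
  have e : margin c ε n * (c.k n * (c.l n * c.q n) : ℕ) =
      ε n * (c.k n * (c.l n * c.q n)) + 5 * (c.k n * c.q n) := by
    rw [margin]; push_cast; field_simp
  rw [sub_mul, e] at h1
  have h2 : 0 ≤ ε n * (c.k n * (c.l n * c.q n)) := by
    have := (hε.mem_Ico n).1
    positivity
  have h3 : (1 : ℝ) ≤ c.k n * c.q n := by nlinarith
  have : ((r % (c.k n * (c.l n * c.q n)) : ℕ) : ℝ) + 1 < (c.k n * (c.l n * c.q n) : ℕ) := by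
    linarith
  exact_mod_cast this

theorem exists_coordinate (hε : IsMaturitySeq ε) {n₀ : ℕ} {r : ℕ → ℕ} (hr : IsTrack c ε n₀ r) :
    ∃ x : ℝ, 0 ≤ x ∧ ∀ n, n₀ ≤ n → (c.p n * r n) % c.q n = ⌊x * c.q n⌋₊ := by
  have key : ∀ n, n₀ ≤ n → (c.p (n + 1) * r (n + 1)) % c.q (n + 1) =
      c.k n * (c.l n * c.q n) * ((c.p n * r n) % c.q n) +
        r (n + 1) % (c.k n * (c.l n * c.q n)) := fun n hn => by
    rw [mul_mod_succ, hr.loc n hn]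
  obtain ⟨x, hx0, hx⟩ := exists_floor_eq (c := c) (n₀ := n₀)
    (i := fun n => (c.p n * r n) % c.q n)
    (fun n hn => by
      simp only [key n hn]
      rw [Nat.mul_add_div (klq_pos c n), Nat.div_eq_of_lt (Nat.mod_lt _ (klq_pos c n)), add_zero])
    (fun n hn => by
      simp only [key n hn]
      rw [Nat.mul_add_mod, Nat.mod_mod]
      exact (hr.good n hn).mod_add_one_lt hε)
  exact ⟨x, hx0, fun n hn => (hx n hn).symm⟩

theorem floor_add_mul {x b y : ℝ} (hx : 0 ≤ x) (hb : 0 ≤ b) (hy : 0 ≤ y) :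
    ⌊(x + b) * y⌋₊ = ⌊x * y⌋₊ + ⌊b * y⌋₊ ∨ ⌊(x + b) * y⌋₊ = ⌊x * y⌋₊ + ⌊b * y⌋₊ + 1 := by
  have h1 := Nat.floor_le (mul_nonneg hx hy)
  have h2 := Nat.floor_le (mul_nonneg hb hy)
  have h3 := Nat.lt_floor_add_one (x * y)
  have h4 := Nat.lt_floor_add_one (b * y)
  have h5 : ⌊x * y⌋₊ + ⌊b * y⌋₊ ≤ ⌊(x + b) * y⌋₊ := by
    apply Nat.le_floor
    push_cast
    linarith
  have h6 : ⌊(x + b) * y⌋₊ < ⌊x * y⌋₊ + ⌊b * y⌋₊ + 2 := by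
    rw [Nat.floor_lt (by positivity)]
    push_cast
    linarith
  omega

theorem mul_jj_mod (n i : ℕ) : (c.p n * jj (c.p n) (c.q n) i) % c.q n = i % c.q n := by
  rw [← ZMod.natCast_eq_natCast_iff']
  push_cast
  exact mul_jj c n i

/-- The locations of a rotated point. -/
theorem exists_rotated_track {n₀ : ℕ} {r : ℕ → ℕ}
    {x b : ℝ} (hx0 : 0 ≤ x) (hb : 0 ≤ b)
    (hx : ∀ n, n₀ ≤ n → (c.p n * r n) % c.q n = ⌊x * c.q n⌋₊)
    (h0 : ∀ n, n₀ ≤ n → IsGood c ε n ((r (n + 1) + rotationShift c b (n + 1)) % c.q (n + 1)))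
    (h1 : ∀ n, n₀ ≤ n → IsGood c ε n ((r (n + 1) + (rotationShift c b (n + 1) +
      jj (c.p (n + 1)) (c.q (n + 1)) 1)) % c.q (n + 1))) :
    ∃ r', IsTrack c ε n₀ r' ∧
      (∀ n, n₀ ≤ n → (c.p n * r' n) % c.q n = ⌊(x + b) * c.q n⌋₊ % c.q n) ∧
      ∀ n, n₀ ≤ n → (r (n + 1) + rotationShift c b (n + 1)) % c.q (n + 1) = r' (n + 1) ∨
        (c.p (n + 1) * ((r (n + 1) + rotationShift c b (n + 1)) % c.q (n + 1)) + 1) %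
          c.q (n + 1) = (c.p (n + 1) * r' (n + 1)) % c.q (n + 1) := by
  have hr' : ∀ n, (c.p n * jj (c.p n) (c.q n) ⌊(x + b) * c.q n⌋₊) % c.q n =
      ⌊(x + b) * c.q n⌋₊ % c.q n := fun n => mul_jj_mod n _
  have hpr : ∀ n, n₀ ≤ n → (c.p n : ZMod (c.q n)) * r n = (⌊x * c.q n⌋₊ : ℕ) := fun n hn => by
    rw [← hx n hn, ZMod.natCast_mod]
    push_cast
    rfl
  -- The two alternatives come from whether the fractional parts of x q_n and b q_n produce a carry.
  -- A carry adds the inverse of p_n to the location, hence the hypothesis `h1` besides `h0`.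
  have cases : ∀ n, n₀ ≤ n →
      jj (c.p n) (c.q n) ⌊(x + b) * c.q n⌋₊ = (r n + rotationShift c b n) % c.q n ∨
      (jj (c.p n) (c.q n) ⌊(x + b) * c.q n⌋₊ =
        (r n + (rotationShift c b n + jj (c.p n) (c.q n) 1)) % c.q n ∧
      (c.p n * ((r n + rotationShift c b n) % c.q n) + 1) % c.q n =
        ⌊(x + b) * c.q n⌋₊ % c.q n) := by
    intro n hn
    rcases floor_add_mul hx0 hb (Nat.cast_nonneg (α := ℝ) (c.q n)) with h | h
    · left
      refine eq_of_mul_mod_eq (jj_lt (c.q_pos n) _) (Nat.mod_lt _ (c.q_pos n)) ?_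
      rw [hr', h, ← ZMod.natCast_eq_natCast_iff']
      push_cast [ZMod.natCast_mod]
      rw [mul_add, hpr n hn, rotationShift, mul_jj]
    · right
      constructor
      · refine eq_of_mul_mod_eq (jj_lt (c.q_pos n) _) (Nat.mod_lt _ (c.q_pos n)) ?_
        rw [hr', h, ← ZMod.natCast_eq_natCast_iff']
        push_cast [ZMod.natCast_mod]
        rw [mul_add, mul_add, hpr n hn, rotationShift, mul_jj, mul_jj]
        push_cast
        ring
      · rw [h, ← ZMod.natCast_eq_natCast_iff']
        push_cast [ZMod.natCast_mod]
        rw [mul_add, hpr n hn, rotationShift, mul_jj]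
  refine ⟨fun n => jj (c.p n) (c.q n) ⌊(x + b) * c.q n⌋₊, ⟨fun n _ => jj_lt (c.q_pos n) _, ?_, ?_⟩,
    fun n _ => hr' n, fun n hn => ?_⟩
  · intro n hn
    rcases cases (n + 1) (by omega) with h | h
    · simp only [h]
      exact h0 n hn
    · simp only [h.1]
      exact h1 n hn
  · intro n hn
    refine locOf_eq_of_mul_mod (I := ⌊(x + b) * c.q (n + 1)⌋₊) (jj_lt (c.q_pos n) _)
      (hr' (n + 1)) ?_
    rw [hr' n, floor_div]
  · rcases cases (n + 1) (by omega) with h | h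
    · exact Or.inl h.symm
    · right
      rw [h.2, hr']

theorem agree_below (hε : IsMaturitySeq ε) {n r r'' : ℕ} (hg : IsGood c ε n r)
    (h : r'' = r ∨ (c.p (n + 1) * r'' + 1) % c.q (n + 1) = (c.p (n + 1) * r) % c.q (n + 1)) :
    IsSafe c n r'' ∧ locOf c n r'' = locOf c n r ∧ sub1 c n r'' = sub1 c n r := by
  rcases h with rfl | h
  · exact ⟨hg.isSafe hε, rfl, rfl⟩
  · obtain ⟨h1, h2, h3⟩ := adjacent_of_isSafe (hg.isSafe hε) h
    have h4 := hg.five_le hε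
    have := c.q_pos n
    exact ⟨⟨by omega, by omega⟩, h2, h1⟩

/-- A point that is not ill-matched at stage `n` has its rotated location in the same argument. -/
theorem sub1_eq_of_not_illMatched (hl : ∀ n, 2 ≤ c.l n) (hε : IsMaturitySeq ε) {β : UnitAddCircle}
    {n₀ : ℕ} (hn₀ : 2 ≤ n₀) {y t : ℤ → Sym Unit} {r r' : ℕ → ℕ} (hr : IsTrack c ε n₀ r)
    (hr' : IsTrack c ε n₀ r') (hy : ∀ n, n₀ ≤ n → IsLocation c n y (r n))
    (ht : ∀ n, n₀ ≤ n → IsLocation c n t (r' n)) (hrot : IsRotation c β y t) {n : ℕ}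
    (hn : n₀ < n) (hill : ¬ IllMatched c ε β n y) :
    sub1 c n (r' (n + 1)) = sub1 c n (r (n + 1)) := by
  have locy : ∀ m, n₀ ≤ m → loc c m y = r m := fun m hm => loc_eq hl (hn₀.trans hm) (hy m hm)
  have loct : ∀ m, n₀ ≤ m → loc c m t = r' m := fun m hm => loc_eq hl (hn₀.trans hm) (ht m hm)
  have hmature : IsMature c ε n y := by
    obtain ⟨m, rfl⟩ : ∃ m, n = m + 1 := ⟨n - 1, by omega⟩
    refine isMature_of_isGood hε fun k hk => ?_
    rw [locy (k + 1) (by omega)]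
    exact ⟨⟨_, hy (k + 1) (by omega)⟩, hr.lt (k + 1) (by omega), hr.good k (by omega)⟩
  -- The first displacement takes the location r (n+1) to r' (n+1); subtracting the second, called e
  -- below, moves left by less than q_n, which stays in the same 1-subsection.
  set D := displacement c (n + 1) y t - displacement c n y t with hD
  have hq := c.q_pos n
  have hq' := c.q_pos (n + 1)
  obtain ⟨e, he⟩ : ∃ e : ℕ, displacement c n y t = e :=
    Int.eq_ofNat_of_zero_le (Int.emod_nonneg _ (by omega))
  have he' : e < c.q n := by
    have := Int.emod_lt_of_pos ((loc c n t : ℤ) - loc c n y) (b := c.q n) (by omega)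
    rw [← displacement, he] at this
    omega
  have hd0 : 0 ≤ displacement c (n + 1) y t := Int.emod_nonneg _ (by omega)
  have hd1 : displacement c (n + 1) y t < c.q (n + 1) := Int.emod_lt_of_pos _ (by omega)
  have hmono : c.q n < c.q (n + 1) := q_strictMono (Nat.lt_succ_self n)
  have hsafe := hr'.isSafe hε n hn.le
  have hle : e ≤ r' (n + 1) := by
    have := hsafe.1
    have := Nat.mod_le (r' (n + 1)) (c.l n * c.q n)
    omega
  -- Safety at stage n+2 applies, as D is small compared with 2 q_{n+1}.
  have hloc : IsLocation c (n + 1) (shiftZ D y) (r' (n + 1) - e) := by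
    have hlt : r' (n + 1) - e < c.q (n + 1) := by have := hr'.lt (n + 1) (by omega); omega
    refine ⟨hlt, ?_⟩
    refine segment_shiftZ_of_isSafe (v := fun _ => circleWord c (n + 1))
      (fun _ => length_circleWord c _) (hr.lt (n + 2) (by omega)) (hr.isSafe hε _ (by omega))
      (hy (n + 2) (by omega)).2 hlt ?_ (by omega) (by omega)
    rw [hr.loc (n + 1) (by omega), hD, he]
    have h1 := Int.emod_add_mul_ediv ((loc c (n + 1) t : ℤ) - loc c (n + 1) y) (c.q (n + 1))
    rw [← displacement, locy _ (by omega), loct _ (by omega)] at h1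
    refine ⟨((r' (n + 1) : ℤ) - r (n + 1)) / c.q (n + 1), ?_⟩
    push_cast [Nat.cast_sub hle]
    linarith
  have hloc' := loc_eq hl (by omega) hloc
  obtain ⟨h1, h2⟩ := sub1_sub (c := c) hsafe he'.le
  by_contra hne
  refine hill ⟨hmature, t, hrot, ⟨_, ht n hn.le⟩, ⟨_, ht (n + 1) (by omega)⟩, ⟨⟨_, hloc⟩, ?_⟩, ?_⟩
  · rw [hloc']
    exact h2
  · rw [argIdx, argIdx, hloc', locy _ (by omega), h1]
    exact hne

end Tracks

/-! ### Almost all points converge -/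

section Final

variable {A : Type*} {c : CoeffSeq} {P : ∀ n, Set (Fin (c.k n) → List (Sym A))} {ε : ℕ → ℝ}

/-- Membership in S gives blocks only at arbitrarily late stages. Good locations allow descent from
these to every stage from some point on, and uniqueness of blocks makes the chosen locations nested.
-/
theorem exists_track (hP : IsCircular c P) (hl : ∀ n, 2 ≤ c.l n) (hε : IsMaturitySeq ε)
    {s : ℤ → Sym A} (hs : s ∈ fullSet (words c P))
    (hg : ∀ᶠ n in atTop, ∀ r, IsLocation c (n + 1) (circleProj s) r → IsGood c ε n r) :
    ∃ n₀, 2 ≤ n₀ ∧ ∃ r, IsTrack c ε n₀ r ∧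
      ∀ n, n₀ ≤ n → IsLocation c n (circleProj s) (r n) ∧
        segment s (-(r n : ℤ)) (c.q n) ∈ words c P n := by
  obtain ⟨N, hN⟩ := eventually_atTop.1 hg
  have hloc : ∀ n r, r < c.q n → segment s (-(r : ℤ)) (c.q n) ∈ words c P n →
      IsLocation c n (circleProj s) r := fun n r hr h =>
    ⟨hr, by rw [segment_circleProj, map_forget_of_mem_words hP n h]⟩
  have hdown : ∀ n, N ≤ n → ∀ r, r < c.q (n + 1) →
      segment s (-(r : ℤ)) (c.q (n + 1)) ∈ words c P (n + 1) →
      segment s (-(locOf c n r : ℤ)) (c.q n) ∈ words c P n := by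
    intro n hn r hr h
    have hgood := hN n hn r (hloc _ _ hr h)
    obtain ⟨v, hv, hvs⟩ := h
    rw [segment_of_isSafe (fun j => length_of_mem_words hP (hP.mem_words n v hv j)) hr
      (hgood.isSafe hε) hvs.symm]
    exact hP.mem_words n v hv _
  have hex : ∀ n, N ≤ n → ∃ r < c.q n, segment s (-(r : ℤ)) (c.q n) ∈ words c P n := by
    intro n hn
    obtain ⟨m, hm, h⟩ := exists_segment_mem_words hP hs n
    revert h
    induction m, hm using Nat.le_induction with
    | base => exact id
    | succ m hm ih =>
      rintro ⟨r, hr, h⟩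
      exact ih ⟨_, locOf_lt c m r, hdown m (by omega) r hr h⟩
  have hex' : ∀ n, ∃ r, N ≤ n → r < c.q n ∧ segment s (-(r : ℤ)) (c.q n) ∈ words c P n := by
    intro n
    by_cases hn : N ≤ n
    · obtain ⟨r, h1, h2⟩ := hex n hn
      exact ⟨r, fun _ => ⟨h1, h2⟩⟩
    · exact ⟨0, fun h => absurd h hn⟩
  choose r hr using hex'
  refine ⟨max N 2, le_max_right _ _, r, ⟨fun n hn => (hr n (by omega)).1, fun n hn => ?_,
    fun n hn => ?_⟩, fun n hn => ⟨hloc n _ (hr n (by omega)).1 (hr n (by omega)).2,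
    (hr n (by omega)).2⟩⟩
  · obtain ⟨h1, h2⟩ := hr (n + 1) (by omega)
    exact hN n (by omega) _ (hloc _ _ h1 h2)
  · obtain ⟨h1, h2⟩ := hr (n + 1) (by omega)
    obtain ⟨h3, h4⟩ := hr n (by omega)
    exact isLocation_unique hl (by omega)
      (hloc n _ (locOf_lt c n _) (hdown n (by omega) _ h1 h2)) (hloc n _ h3 h4)

/-- The nesting argument is run twice. In the circle factor there is one word per stage, so matching
is automatic and the limit t is the rotate of π(s). Only with t at hand does the absence of
ill-matching yield matching indices, which make the translates of s itself converge. -/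
theorem exists_limit_of_track (hP : IsCircular c P) (hl : ∀ n, 2 ≤ c.l n) (hε : IsMaturitySeq ε)
    {s : ℤ → Sym A} {b : ℝ} (hb : 0 ≤ b) {n₀ : ℕ} (hn₀ : 2 ≤ n₀) {r : ℕ → ℕ}
    (hr : IsTrack c ε n₀ r)
    (hs : ∀ n, n₀ ≤ n → IsLocation c n (circleProj s) (r n) ∧
      segment s (-(r n : ℤ)) (c.q n) ∈ words c P n)
    (h0 : ∀ n, n₀ ≤ n → IsGood c ε n ((r (n + 1) + rotationShift c b (n + 1)) % c.q (n + 1)))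
    (h1 : ∀ n, n₀ ≤ n → IsGood c ε n ((r (n + 1) + (rotationShift c b (n + 1) +
      jj (c.p (n + 1)) (c.q (n + 1)) 1)) % c.q (n + 1)))
    (hill : ∀ n, n₀ ≤ n → ¬ IllMatched c ε (b : UnitAddCircle) n (circleProj s)) :
    ∃ z, Tendsto (fun n => shiftZ (rotationShift c b n : ℤ) s) atTop (𝓝 z) ∧
      IsRotation c (b : UnitAddCircle) (circleProj s) (circleProj z) := by
  obtain ⟨x, hx0, hx⟩ := exists_coordinate hε hr
  obtain ⟨r', hr', hz, hadj⟩ := exists_rotated_track hx0 hb hx h0 h1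
  have hbelow := fun n hn => agree_below hε (hr'.good n hn) (hadj n hn)
  obtain ⟨t, -, ht⟩ := exists_tendsto_of_nested (x := circleProj s) (n₀ := n₀)
    (V := circleWord c) (v := fun n _ => circleWord c n) (r := r) (r' := r')
    (r'' := fun n => (r n + rotationShift c b n) % c.q n) (d := rotationShift c b)
    (fun n _ _ => length_circleWord c n) (fun n _ => rfl) (fun n hn => (hs n hn).1.2)
    hr.lt hr'.lt (hr.isSafe hε) (hr'.isSafe hε) (fun n hn => (hbelow n hn).1) hr.loc hr'.loc
    (fun n hn => (hbelow n hn).2.1.trans (hr'.loc n hn)) (fun n hn => (hbelow n hn).2.2)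
    (fun n _ => rfl) (fun n _ => jj_lt (c.q_pos n) _) (fun n _ => rfl)
  have htloc : ∀ n, n₀ ≤ n → IsLocation c n t (r' n) := fun n hn => ⟨hr'.lt n hn, ht n hn⟩
  have hrot : IsRotation c (b : UnitAddCircle) (circleProj s) t := by
    refine ⟨mem_circleFullSet (fun n hn => (hs n hn).1) (hr.isSafe hε),
      mem_circleFullSet htloc (hr'.isSafe hε), (x : UnitAddCircle), ?_, ?_⟩
    · refine isCircleCoord_of_floor hl hn₀ (fun n hn => (hs n hn).1) hx0 fun n hn => ?_
      rw [← hx n hn, Nat.mod_mod]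
    · rw [← AddCircle.coe_add]
      exact isCircleCoord_of_floor hl hn₀ htloc (add_nonneg hx0 hb) hz
  -- One stage is lost here because maturity at n uses goodness at index n - 1.
  have hmatch : ∀ n, n₀ + 1 ≤ n → sub1 c n (r' (n + 1)) = sub1 c n (r (n + 1)) := fun n hn =>
    sub1_eq_of_not_illMatched hl hε hn₀ hr hr' (fun n hn => (hs n hn).1) htloc hrot (by omega)
      (hill n (by omega))
  have hex : ∀ n, ∃ v : Fin (c.k n) → List (Sym A), n₀ ≤ n →
      v ∈ P n ∧ c.circ n v = segment s (-(r (n + 1) : ℤ)) (c.q (n + 1)) := by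
    intro n
    by_cases hn : n₀ ≤ n
    · obtain ⟨v, hv, h⟩ := (hs (n + 1) (by omega)).2
      exact ⟨v, fun _ => ⟨hv, h⟩⟩
    · exact ⟨fun _ => [], fun h => absurd h hn⟩
  choose v hv using hex
  have hvlen : ∀ n, n₀ ≤ n → ∀ j, (v n j).length = c.q n := fun n hn j =>
    length_of_mem_words hP (hP.mem_words n _ (hv n hn).1 j)
  have hge : ∀ n, n₀ + 1 ≤ n → n₀ ≤ n := fun n hn => by omega
  have hr1 := hr.mono (Nat.le_succ n₀)
  have hr1' := hr'.mono (Nat.le_succ n₀)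
  obtain ⟨z, hlim, hzs⟩ := exists_tendsto_of_nested (x := s) (n₀ := n₀ + 1)
    (V := fun n => segment s (-(r n : ℤ)) (c.q n)) (v := v) (r := r) (r' := r')
    (r'' := fun n => (r n + rotationShift c b n) % c.q n) (d := rotationShift c b)
    (fun n hn => hvlen n (hge n hn)) (fun n hn => (hv n (hge n hn)).2.symm) (fun n _ => rfl)
    hr1.lt hr1'.lt (hr1.isSafe hε) (hr1'.isSafe hε) (fun n hn => (hbelow n (hge n hn)).1) hr1.loc
    hr1'.loc (fun n hn => (hbelow n (hge n hn)).2.1.trans (hr1'.loc n hn))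
    (fun n hn => (hbelow n (hge n hn)).2.2)
    (fun n hn => by
      have e := segment_of_isSafe (hvlen n (hge n hn)) (hr1.lt (n + 1) (by omega))
        (hr1.isSafe hε n hn) (hv n (hge n hn)).2.symm
      rw [hr1.loc n hn] at e
      rw [e]
      congr 1
      exact Fin.ext (hmatch n hn))
    (fun n _ => jj_lt (c.q_pos n) _) (fun n _ => rfl)
  refine ⟨z, hlim, ?_⟩
  -- Both sequences have blocks at the same locations r', and these blocks exhaust ℤ.
  have : circleProj z = t := by
    refine eq_of_isLocation (n₀ := n₀ + 1) (ρ := r') (fun n hn => ⟨hr1'.lt n hn, ?_⟩)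
      (fun n hn => htloc n (hge n hn)) (hr1'.isSafe hε)
    rw [segment_circleProj, hzs n hn, map_forget_of_mem_words hP n (hs n (hge n hn)).2]
  rw [this]
  exact hrot

instance [Countable A] : Countable (Sym A) := by
  refine Function.Injective.countable (β := Option (Option A)) (f := fun x => match x with
    | Sym.letter a => some (some a)
    | Sym.b => some none
    | Sym.e => none) ?_
  intro x y h
  cases x <;> cases y <;> simp_all

instance : BorelSpace (Sym A) := ⟨borel_eq_top_of_discrete.symm⟩

end Final

end Circular

/-! ### Assembly by Borel–Cantelli -/

open Circular in
theorem mainTheorem4 {A : Type*} [Countable A] [Nonempty A] (c : CoeffSeq)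
    (P : ∀ n, Set (Fin (c.k n) → List (Sym A))) (hP : IsCircular c P) (hU : IsUniform c P)
    (ν : Measure (ℤ → Sym A)) [IsProbabilityMeasure ν]
    (hT : MeasurePreserving (shiftZ 1) ν ν) (hS : ∀ᵐ s ∂ν, s ∈ fullSet (words c P))
    (ε : ℕ → ℝ) (hε : IsMaturitySeq ε) (β : UnitAddCircle) (hβ : IsCentral c ε ν β) :
    ∃ (a : ℕ → ℤ) (Tstar : MPT ν),
      (∀ᵐ s ∂ν, Tendsto (fun n => shiftZ (a n) s) atTop (𝓝 (Tstar.toFun s))) ∧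
      Tendsto (fun n => shiftPow hT (a n)) atTop (𝓝 Tstar) ∧
      MPT.InCentralizer (shiftPow hT 1) Tstar ∧
      HasRotationFactor c Tstar β ∧
      Tstar ∈ closure (Set.range (shiftPow hT)) := by
  obtain ⟨s₀, hs₀⟩ := hS.exists
  have hl := two_le_l hP (words_nonempty hP hs₀)
  -- A nonnegative representative allows natural-number floors throughout.
  obtain ⟨b, hb, rfl⟩ : ∃ b : ℝ, 0 ≤ b ∧ (b : UnitAddCircle) = β := by
    obtain ⟨y, rfl⟩ := QuotientAddGroup.mk_surjective β
    refine ⟨Int.fract y, Int.fract_nonneg y, ?_⟩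
    have hfloor : ((⌊y⌋ : ℝ) : UnitAddCircle) = 0 := by
      rw [AddCircle.coe_eq_zero_iff]
      exact ⟨⌊y⌋, by simp⟩
    change ((Int.fract y : ℝ) : UnitAddCircle) = (y : UnitAddCircle)
    conv_rhs => rw [← Int.fract_add_floor y, AddCircle.coe_add, hfloor, add_zero]
  -- Goodness is needed at the location of s and at both candidates for the rotated location,
  -- without and with carry.
  have h0 := ae_eventually_isGood hT hl hε fun _ => 0
  have h1 := ae_eventually_isGood hT hl hε fun n => rotationShift c b (n + 1)
  have h2 := ae_eventually_isGood hT hl hε fun n =>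
    rotationShift c b (n + 1) + jj (c.p (n + 1)) (c.q (n + 1)) 1
  have h3 := ae_eventually_notMem (μ := ν) (ne_of_lt hβ)
  have key : ∀ᵐ s ∂ν, ∃ z, Tendsto (fun n => shiftZ (rotationShift c b n : ℤ) s) atTop (𝓝 z) ∧
      IsRotation c (b : UnitAddCircle) (circleProj s) (circleProj z) := by
    filter_upwards [hS, h0, h1, h2, h3] with s hs h0 h1 h2 h3
    obtain ⟨n₀, hn₀, r, hr, hrs⟩ := exists_track hP hl hε hs <| by
      filter_upwards [h0] with n hn r hr
      have := hn r hr
      rwa [add_zero, Nat.mod_eq_of_lt hr.1] at this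
    obtain ⟨N, hN⟩ := eventually_atTop.1 (h1.and (h2.and h3))
    have hge : ∀ n, max n₀ N ≤ n → n₀ ≤ n ∧ N ≤ n := fun n hn => by omega
    have hloc : ∀ n, max n₀ N ≤ n → IsLocation c (n + 1) (circleProj s) (r (n + 1)) :=
      fun n hn => (hrs (n + 1) (by omega)).1
    exact exists_limit_of_track hP hl hε hb (hn₀.trans (le_max_left n₀ N))
      (hr.mono (le_max_left n₀ N)) (fun n hn => hrs n (hge n hn).1)
      (fun n hn => (hN n (hge n hn).2).1 _ (hloc n hn))
      (fun n hn => (hN n (hge n hn).2).2.1 _ (hloc n hn))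
      (fun n hn => (hN n (hge n hn).2).2.2)
  obtain ⟨S, hlim, hweak, hcomm, hcl⟩ := exists_MPT_limit hT
    (a := fun n => (rotationShift c b n : ℤ)) (key.mono fun s ⟨z, hz, _⟩ => ⟨z, hz⟩)
  refine ⟨fun n => (rotationShift c b n : ℤ), S, hlim, hweak, hcomm, ?_, hcl⟩
  filter_upwards [key, hlim] with s ⟨z, hz, hrot⟩ hs
  rw [tendsto_nhds_unique hs hz]
  exact hrot
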